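/- Let $n\ge 2$ and $d\ge 3$. There are constants $K$ and $P$, depending only on $n$ and $d$, with the following property. Let $q$ be either a prime or a product $p_1p_2$ of primes with $p_1<p_2<2p_1$, and suppose that every prime factor of $q$ is at least $P$. Let $h,g\in\mathbb{Z}[x_1,\dots,x_n]$ with $\deg h\le\deg g=d$, and let $G$ be the leading form of $g$ (the leading form of a polynomial of degree $e$ is the sum of its terms of degree exactly $e$). A form $F$ over $\mathbb{F}_p$ is called nonsingular if its singular locus $\{F=0,\ \nabla F=\mathbf{0}\}$ in affine space over $\overline{\mathbb{F}}_p$ contains no point other than the origin. Assume that: * $G$ is nonsingular modulo $p$ for every prime $p\mid q$; * either $\deg h<d$, or the leading form of $h$ is a constant multiple of $G$. (Hence for each prime $p\mid q$ there is exactly one $\gamma=\gamma_p\in\mathbb{F}_p$ for which $h-\gamma g$ has degree less than $d$ over $\mathbb{F}_p$.); * for each prime $p\mid q$ the leading form $H_p\in\mathbb{F}_p[x_1,\dots,x_n]$ of $h-\gamma_p g$ has degree at least $2$. Let $s(h,g;p)$ be the dimension of the singular locus $\{H_p=0,\ \nabla H_p=\mathbf{0}\}$ in $\mathbb{A}^n$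 over $\overline{\mathbb{F}}_p$. Then there is a matrix $M\in \mathrm{SL}_n(\mathbb{Z})$, all of whose entries have absolute value at most $K$, such that, writing $$f_{M,c}(y_1,\dots,y_{n-1})=f\bigl(M(y_1,\dots,y_{n-1},c)^{T}\bigr)$$ for $f\in\{g,h\}$, the following hold for every prime $p\mid q$ and every $c\in\mathbb{Z}$: 1. $g_{M,c}$ has degree $d$ modulo $p$, and its leading form is nonsingular modulo $p$; 2. the leading form of $h_{M,c}-\gamma_p g_{M,c}$ over $\mathbb{F}_p$ has degree at least $2$, and its singular locus has dimension at most $\max(s(h,g;p)-1,\,0)$. -/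

import Mathlib

open MvPolynomial
open scoped MatrixGroups

/-- The leading form of a polynomial: the sum of its terms of degree exactly `f.totalDegree`. -/
noncomputable def leadingForm {σ R : Type*} [CommRing R] (f : MvPolynomial σ R) :
    MvPolynomial σ R :=
  homogeneousComponent f.totalDegree f

/-- The reduction modulo `p` of an integral polynomial. -/
noncomputable def modP {σ : Type*} (p : ℕ) (f : MvPolynomial σ ℤ) : MvPolynomial σ (ZMod p) :=
  map (Int.castRingHom (ZMod p)) f

/-- The singular locus of the hypersurface `F = 0` of affine space, as a set of points over the
algebraic closure of `𝔽_p`: the points where `F` and all its partial derivatives vanish. -/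
def singularLocus {σ : Type*} (p : ℕ) [Fact p.Prime] (F : MvPolynomial σ (ZMod p)) :
    Set (σ → AlgebraicClosure (ZMod p)) :=
  {x | aeval x F = 0 ∧ ∀ i, aeval x (pderiv i F) = 0}

/-- A form over `𝔽_p` is nonsingular if the projective hypersurface it defines is smooth, that is,
if its affine singular locus contains no point other than the origin. -/
def IsNonsingularForm {σ : Type*} (p : ℕ) [Fact p.Prime] (F : MvPolynomial σ (ZMod p)) : Prop :=
  ∀ x ∈ singularLocus p F, x = 0

/-- The dimension of an algebraic subset `V` of affine space over a field `K`: the Krull dimension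
of its coordinate ring (so it is `⊥` for the empty set). -/
noncomputable def affineDim {σ K : Type*} [Field K] (V : Set (σ → K)) : WithBot ℕ∞ :=
  ringKrullDim (MvPolynomial σ K ⧸ vanishingIdeal K V)

/-- The polynomial `h - γ g` over `𝔽_p`. -/
noncomputable def pencil {σ : Type*} (p : ℕ) (h g : MvPolynomial σ ℤ) (γ : ZMod p) :
    MvPolynomial σ (ZMod p) :=
  modP p h - C γ * modP p g

/-- `q` is prime, or a product of two primes `p₁ < p₂ < 2 p₁`. -/
def IsSieveModulus (q : ℕ) : Prop :=
  q.Prime ∨ ∃ p₁ p₂ : ℕ, p₁.Prime ∧ p₂.Prime ∧ p₁ < p₂ ∧ p₂ < 2 * p₁ ∧ q = p₁ * p₂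

/-- The standing assumptions on the modulus `q`, the degree `d` and the integral polynomials
`h`, `g`. -/
structure IsAdmissible {n : ℕ} (d q : ℕ) (h g : MvPolynomial (Fin n) ℤ) : Prop where
  modulus : IsSieveModulus q
  three_le : 3 ≤ d
  degree_g : g.totalDegree = d
  degree_h : h.totalDegree ≤ d
  /-- The leading form of `g` is nonsingular modulo every prime factor of `q`. -/
  nonsingular : ∀ (p : ℕ) [Fact p.Prime], p ∣ q → IsNonsingularForm p (modP p (leadingForm g))
  /-- Either `deg h < d`, or the leading form of `h` is a constant multiple of that of `g`. -/
  leading_h : h.totalDegree < d ∨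
    ∃ κ : ℚ, map (Int.castRingHom ℚ) (leadingForm h) =
      C κ * map (Int.castRingHom ℚ) (leadingForm g)
  /-- For the `γ` modulo `p` for which `h - γ g` has degree less than `d` over `𝔽_p`, this
  polynomial has degree at least two. -/
  two_le_degree : ∀ (p : ℕ) [Fact p.Prime], p ∣ q → ∀ γ : ZMod p,
    (pencil p h g γ).totalDegree < d → 2 ≤ (pencil p h g γ).totalDegree

/-- `f_M(x) = f(M x)`. -/
noncomputable def linearSubst {n : ℕ} (M : SL(n, ℤ)) (f : MvPolynomial (Fin n) ℤ) :
    MvPolynomial (Fin n) ℤ :=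
  bind₁ (fun i => ∑ j, C (M.1 i j) * X j) f

/-- `f_{M,c}(y) = f_M(y, c)`, a polynomial in one variable fewer. -/
noncomputable def hyperplaneSection {m : ℕ} (M : SL(m + 1, ℤ)) (c : ℤ)
    (f : MvPolynomial (Fin (m + 1)) ℤ) : MvPolynomial (Fin m) ℤ :=
  bind₁ (Fin.snoc (α := fun _ => MvPolynomial (Fin m) ℤ) X (C c)) (linearSubst M f)

/-! Take `M` unipotent with last row `(-a, 1)`, so that sections are restrictions to the hyperplanes
`x_m = c - ∑ aᵢ xᵢ`. The top-degree part of a section is the restriction of the leading form to the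
parallel hyperplane `H_a` through the origin, as long as that is nonzero. So `c` plays no role, and
it is enough to find a small `a` for which `H_a` cuts `G` and `H_p` well, for each `p ∣ q`.

Let `F` be one of these forms, over the algebraic closure. At a singular point `x` of `F` restricted
to `H_a`, the gradient of `F` is `μ • (a, 1)` for some `μ`. A dimension count
(`exists_dvd_aeval_pderiv`) provides a nonzero form `Ψ` of bounded degree `t` with `F ∣ Ψ(∇F)`, so
`μ ^ t * Ψ(a, 1) = 0`. If `Ψ(a, 1) ≠ 0`, then `μ = 0` and `x` is a singular point of `F` itself;
this is valid in every characteristic.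

Dimension is measured by linear sections: a closed cone has dimension at most `s` exactly when some
`s` linear forms cut it down to the origin (`exists_linear_section_eq_zero`,
`affineDim_le_of_linear_section`). Letting `H_a` play the part of one of these forms lowers the
count by one, and by `exists_elimination_bound` this is possible for all `a` off some hypersurface.
`exists_bertini_bound` combines the two conditions on `a`.

The degrees of the exceptional hypersurfaces do not depend on `p`, because elimination is carried
out once and for all over `ℤ`. As `q` has at most two prime factors, Schwartz–Zippel
(`exists_common_nonvanishing`) yields one `a` in a bounded box that is good for all of them. -/

/-! ### Forms, Macaulay matrices and elimination over `ℤ` -/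

/-- The exponents of total degree `N` in finitely many variables. -/
noncomputable def exponentsOfDegree (σ : Type*) [Fintype σ] [DecidableEq σ] (N : ℕ) :
    Finset (σ →₀ ℕ) :=
  Finset.univ.finsuppAntidiag N

theorem mem_exponentsOfDegree {σ : Type*} [Fintype σ] [DecidableEq σ] {N : ℕ} {α : σ →₀ ℕ} :
    α ∈ exponentsOfDegree σ N ↔ α.degree = N := by
  simp [exponentsOfDegree, Finsupp.degree_eq_sum]

theorem card_exponentsOfDegree (σ : Type*) [Fintype σ] [DecidableEq σ] (N : ℕ) :
    (exponentsOfDegree σ N).card = (Fintype.card σ).multichoose N := by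
  simp [exponentsOfDegree, Finset.card_finsuppAntidiag_nat_eq_multichoose]

theorem MvPolynomial.IsHomogeneous.eq_sum_monomial {σ R : Type*} [Fintype σ] [DecidableEq σ]
    [CommRing R] {N : ℕ} {f : MvPolynomial σ R} (hf : f.IsHomogeneous N) :
    f = ∑ α : exponentsOfDegree σ N, monomial α.1 (coeff α.1 f) := by
  rw [Finset.sum_coe_sort (exponentsOfDegree σ N) (fun α => monomial α (coeff α f))]
  conv_lhs => rw [f.as_sum]
  refine Finset.sum_subset (fun α hα => ?_) (fun α _ hα => ?_)
  · rw [mem_exponentsOfDegree]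
    by_contra h
    exact (mem_support_iff.1 hα) (hf.coeff_eq_zero h)
  · rw [notMem_support_iff.1 hα, map_zero]

theorem MvPolynomial.homogeneousComponent_mul_of_isHomogeneous {σ R : Type*} [CommRing R]
    {N δ : ℕ} (q : MvPolynomial σ R) {f : MvPolynomial σ R} (hf : f.IsHomogeneous δ)
    (h : δ ≤ N) :
    homogeneousComponent N (q * f) = homogeneousComponent (N - δ) q * f := by
  classical
  conv_lhs => rw [← sum_homogeneousComponent q, Finset.sum_mul, map_sum]
  have key : ∀ i, homogeneousComponent N (homogeneousComponent i q * f) =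
      if i = N - δ then homogeneousComponent (N - δ) q * f else 0 := by
    intro i
    rw [homogeneousComponent_of_mem ((homogeneousComponent_isHomogeneous i q).mul hf)]
    by_cases hi : i = N - δ
    · subst hi
      rw [if_pos (by omega), if_pos rfl]
    · rw [if_neg (by omega), if_neg hi]
  simp_rw [key]
  rw [Finset.sum_ite_eq']
  split_ifs with hmem
  · rfl
  · rw [homogeneousComponent_eq_zero _ _ (by simp at hmem; omega), zero_mul]

/-- A matrix whose specialization is surjective has a maximal minor that does not vanish under the
specialization. -/
theorem Matrix.exists_det_submatrix_ne_zero {a b R K : Type*} [Fintype a] [Fintype b]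
    [DecidableEq b] [CommRing R] [Field K] (φ : R →+* K) (T : Matrix b a R)
    (hT : ⊤ ≤ Submodule.span K (Set.range fun (j : a) (i : b) => φ (T i j))) :
    ∃ g : b → a, φ (T.submatrix id g).det ≠ 0 := by
  obtain ⟨s, hs, hspan, hli⟩ := exists_linearIndependent K (Set.range fun (j : a) (i : b) => φ (T i j))
  let B : Module.Basis s K (b → K) := Module.Basis.mk hli (by
    rw [Subtype.range_coe, hspan]; exact hT)
  let e : s ≃ b := B.indexEquiv (Pi.basisFun K b)
  choose c hc using fun x : s => hs x.2
  refine ⟨fun i => c (e.symm i), ?_⟩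
  rw [RingHom.map_det, ← isUnit_iff_ne_zero, ← Matrix.isUnit_iff_isUnit_det,
    ← Matrix.linearIndependent_cols_iff_isUnit]
  have h := hli.comp e.symm e.symm.injective
  have h' : ((Subtype.val : s → b → K) ∘ e.symm) =
      (φ.mapMatrix (T.submatrix id fun i => c (e.symm i))).col := by
    funext i
    simp only [Function.comp_apply]
    rw [← hc]
    rfl
  rwa [h'] at h

/-- If forms of degree `N` span all monomials of degree `N` after specialization to a field, then
some common multiple of these monomials, nonzero after specialization, lies in the ideal that the
forms generate. -/
theorem exists_smul_monomial_mem_span {σ a R K : Type*} [Fintype σ] [DecidableEq σ] [Fintype a]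
    [CommRing R] [Field K] (φ : R →+* K) {N : ℕ} (P : a → MvPolynomial σ R)
    (hP : ∀ j, (P j).IsHomogeneous N)
    (hspan : ∀ α : σ →₀ ℕ, α.degree = N →
      monomial α (1 : K) ∈ Submodule.span K (Set.range fun j => map φ (P j))) :
    ∃ r : R, φ r ≠ 0 ∧ ∀ α : σ →₀ ℕ, α.degree = N →
      monomial α r ∈ Ideal.span (Set.range P) := by
  let T : Matrix (exponentsOfDegree σ N) a R := fun α j => coeff α.1 (P j)
  obtain ⟨g, hg⟩ := Matrix.exists_det_submatrix_ne_zero φ T (by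
    intro v _
    have hv : v = ∑ α, v α • (Pi.single α 1 : exponentsOfDegree σ N → K) := by
      funext β
      simp [Finset.sum_apply, Pi.single_apply]
    rw [hv]
    refine Submodule.sum_mem _ fun α _ => Submodule.smul_mem _ _ ?_
    let L : MvPolynomial σ K →ₗ[K] (exponentsOfDegree σ N → K) :=
      LinearMap.pi fun β => lcoeff K β.1
    have h1 := Submodule.mem_map_of_mem (f := L) (hspan α.1 (mem_exponentsOfDegree.1 α.2))
    rw [Submodule.map_span, ← Set.range_comp] at h1
    have e1 : L (monomial α.1 1) = Pi.single α 1 := by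
      funext β
      change coeff β.1 (monomial α.1 1) = _
      rw [coeff_monomial, Pi.single_apply]
      exact if_congr (Subtype.ext_iff.symm.trans eq_comm) rfl rfl
    have e2 : (L ∘ fun j => map φ (P j)) = fun (j : a) (i : exponentsOfDegree σ N) => φ (T i j) := by
      funext j β
      simp [L, T, coeff_map]
    rwa [e1, e2] at h1)
  refine ⟨_, hg, fun α hα => ?_⟩
  let A : Matrix (exponentsOfDegree σ N) (exponentsOfDegree σ N) R := T.submatrix id g
  have hα' := mem_exponentsOfDegree.2 hα
  change monomial α A.det ∈ _
  -- Cramer's rule: a column of the adjugate expresses the determinant times a monomial through the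
  -- chosen forms.
  have key : monomial α A.det = ∑ i, C (A.adjugate i ⟨α, hα'⟩) * P (g i) := by
    ext β
    rw [coeff_sum]
    simp only [coeff_C_mul]
    by_cases hβ : β.degree = N
    · have h2 := congrFun (congrFun (Matrix.mul_adjugate A) ⟨β, mem_exponentsOfDegree.2 hβ⟩)
        ⟨α, hα'⟩
      rw [Matrix.mul_apply] at h2
      rw [Matrix.smul_apply, smul_eq_mul, Matrix.one_apply, mul_ite, mul_one, mul_zero] at h2
      rw [coeff_monomial]
      refine Eq.trans ?_ (h2.symm.trans (Finset.sum_congr rfl fun i _ => mul_comm _ _))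
      simp [eq_comm]
    · rw [coeff_monomial, if_neg (fun h : α = β => hβ (h ▸ hα))]
      symm
      refine Finset.sum_eq_zero fun i _ => ?_
      rw [(hP _).coeff_eq_zero hβ, mul_zero]
  rw [key]
  exact Ideal.sum_mem _ fun i _ => Ideal.mul_mem_left _ _ (Ideal.subset_span ⟨_, rfl⟩)

/-- If polynomials over an algebraically closed field have no common zero but the origin, then
they generate an ideal containing all monomials of large degree. -/
theorem exists_pow_idealOfVars_le {σ K : Type*} [Finite σ] [Field K] [IsAlgClosed K]
    (I : Ideal (MvPolynomial σ K)) (hI : ∀ x ∈ zeroLocus K I, x = 0) :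
    ∃ N, idealOfVars σ K ^ N ≤ I := by
  refine Ideal.exists_pow_le_of_le_radical_of_fg ?_ (idealOfVars_fg σ K)
  rw [← vanishingIdeal_zeroLocus_eq_radical (K := K), idealOfVars, Ideal.span_le]
  rintro _ ⟨i, rfl⟩ x hx
  simp [hI x hx]

theorem MvPolynomial.IsHomogeneous.eval_smul {σ K : Type*} [CommRing K] {n : ℕ}
    {f : MvPolynomial σ K} (hf : f.IsHomogeneous n) (c : K) (x : σ → K) :
    eval (c • x) f = c ^ n * eval x f := by
  rw [eval_eq, eval_eq, Finset.mul_sum]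
  refine Finset.sum_congr rfl fun d hd => ?_
  have h : ∑ i ∈ d.support, d i = n := by
    rw [← Finsupp.degree_apply]
    by_contra h
    exact (mem_support_iff.1 hd) (hf.coeff_eq_zero h)
  simp only [Pi.smul_apply, smul_eq_mul, mul_pow, Finset.prod_mul_distrib, Finset.prod_pow_eq_pow_sum,
    h]
  ring

/-- Elimination theory: having no common zero but the origin is, for families of forms of given
degrees, a Zariski open condition on the coefficients, defined by polynomials whose degree is
bounded independently of the field. -/
theorem exists_elimination_bound {J σ : Type} [Fintype J] [Fintype σ] (δ : J → ℕ) :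
    ∃ D : ℕ, ∀ (K : Type) [Field K] [IsAlgClosed K] (f₀ : J → MvPolynomial σ K),
      (∀ j, (f₀ j).IsHomogeneous (δ j)) → (∀ x : σ → K, (∀ j, eval x (f₀ j) = 0) → x = 0) →
      ∃ Φ : MvPolynomial (J × (σ →₀ ℕ)) K, Φ.totalDegree ≤ D ∧
        eval (fun c => coeff c.2 (f₀ c.1)) Φ ≠ 0 ∧
        ∀ f : J → MvPolynomial σ K, (∀ j, (f j).IsHomogeneous (δ j)) →
          eval (fun c => coeff c.2 (f c.1)) Φ ≠ 0 →
          ∀ x : σ → K, (∀ j, eval x (f j) = 0) → x = 0 := by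
  classical
  let ι := Σ j : J, exponentsOfDegree σ (δ j)
  -- The universal forms of degrees `δ j`, with indeterminate coefficients.
  let F : J → MvPolynomial σ (MvPolynomial ι ℤ) := fun j =>
    ∑ α : exponentsOfDegree σ (δ j), monomial α.1 (X ⟨j, α⟩)
  have hF : ∀ j, (F j).IsHomogeneous (δ j) := fun j =>
    IsHomogeneous.sum _ _ _ fun α _ => isHomogeneous_monomial _ (mem_exponentsOfDegree.1 α.2)
  let S := Ideal.span (Set.range F)
  -- The elimination ideal: those `r` that carry all monomials of some degree into the ideal of the
  -- universal forms. If `r` is nonzero at a given family, that family has only the trivial zero.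
  let I : Ideal (MvPolynomial ι ℤ) :=
    { carrier := {r | ∃ N, ∀ α : σ →₀ ℕ, α.degree = N → monomial α r ∈ S}
      zero_mem' := ⟨0, fun α _ => by simp⟩
      smul_mem' := fun c r ⟨N, h⟩ => ⟨N, fun α hα => by
        have : monomial α (c • r) = C c * monomial α r := by rw [C_mul_monomial, smul_eq_mul]
        rw [this]
        exact Ideal.mul_mem_left _ _ (h α hα)⟩
      add_mem' := by
        have mono : ∀ (r : MvPolynomial ι ℤ) (N M : ℕ), N ≤ M →
            (∀ α : σ →₀ ℕ, α.degree = N → monomial α r ∈ S) →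
            ∀ α : σ →₀ ℕ, α.degree = M → monomial α r ∈ S := by
          intro r N M hNM h α hα
          have h1 : monomial α (1 : MvPolynomial ι ℤ) ∈
              idealOfVars σ (MvPolynomial ι ℤ) ^ N :=
            (monomial_mem_pow_idealOfVars_iff N α one_ne_zero).2 (by omega)
          rw [pow_idealOfVars_eq_span] at h1
          have h2 : ∀ p ∈ Ideal.span ((fun x ↦ monomial x (1 : MvPolynomial ι ℤ)) ''
              {x : σ →₀ ℕ | x.degree = N}), C r * p ∈ S := by
            intro p hp
            induction hp using Submodule.span_induction with
            | mem p hp =>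
              obtain ⟨β, hβ, rfl⟩ := hp
              rw [C_mul_monomial, mul_one]
              exact h β hβ
            | zero => simp
            | add p q _ _ hp hq => rw [mul_add]; exact S.add_mem hp hq
            | smul c p _ hp => rw [smul_eq_mul, mul_left_comm]; exact S.mul_mem_left _ hp
          have h3 := h2 _ h1
          rwa [C_mul_monomial, mul_one] at h3
        rintro r s ⟨N, h⟩ ⟨M, h'⟩
        refine ⟨max N M, fun α hα => ?_⟩
        rw [map_add]
        exact S.add_mem (mono r N _ (le_max_left _ _) h α hα)
          (mono s M _ (le_max_right _ _) h' α hα) }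
  -- The bound comes from Hilbert's basis theorem over `ℤ`, before any field is chosen; this makes
  -- it uniform.
  obtain ⟨gens, hgens⟩ : I.FG := IsNoetherian.noetherian I
  refine ⟨gens.sup totalDegree, fun K _ _ f₀ hf₀ hzero => ?_⟩
  let φ : (J → MvPolynomial σ K) → MvPolynomial ι ℤ →+* K := fun f =>
    eval₂Hom (Int.castRingHom K) (fun c => coeff c.2.1 (f c.1))
  have hφ : ∀ f : J → MvPolynomial σ K, (∀ j, (f j).IsHomogeneous (δ j)) →
      ∀ j, map (φ f) (F j) = f j := by
    intro f hf j
    conv_rhs => rw [(hf j).eq_sum_monomial]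
    simp [F, φ, map_monomial]
  have hex : ∃ r ∈ I, φ f₀ r ≠ 0 := by
    obtain ⟨N₀, hN₀⟩ := exists_pow_idealOfVars_le (Ideal.span (Set.range f₀)) (by
      intro x hx
      refine hzero x fun j => ?_
      simpa [aeval_eq_eval] using hx (f₀ j) (Ideal.subset_span ⟨j, rfl⟩))
    -- The sum is added so that every `N - δ j` is a genuine difference.
    let N := N₀ + ∑ j, δ j
    have hδN : ∀ j, δ j ≤ N := fun j =>
      (Finset.single_le_sum (fun _ _ => Nat.zero_le _) (Finset.mem_univ j)).trans
        (Nat.le_add_left _ _)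
    let P : (Σ j : J, exponentsOfDegree σ (N - δ j)) → MvPolynomial σ (MvPolynomial ι ℤ) :=
      fun c => monomial c.2.1 1 * F c.1
    obtain ⟨r, hr, hr'⟩ := exists_smul_monomial_mem_span (φ f₀) (N := N) P (by
      rintro ⟨j, α⟩
      have h := (isHomogeneous_monomial (1 : MvPolynomial ι ℤ)
        (mem_exponentsOfDegree.1 α.2)).mul (hF j)
      rwa [Nat.sub_add_cancel (hδN j)] at h) (by
      intro α hα
      have h1 : monomial α (1 : K) ∈ Ideal.span (Set.range f₀) := hN₀
        ((monomial_mem_pow_idealOfVars_iff N₀ α one_ne_zero).2 (by rw [hα]; omega))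
      obtain ⟨q, hq⟩ := Ideal.mem_span_range_iff_exists_fun.1 h1
      have h2 : monomial α (1 : K) =
          ∑ j, homogeneousComponent (N - δ j) (q j) * f₀ j := by
        have h3 := congrArg (homogeneousComponent N) hq
        rw [map_sum, homogeneousComponent_eq_self (isHomogeneous_monomial _ hα)] at h3
        rw [← h3]
        exact Finset.sum_congr rfl fun j _ =>
          homogeneousComponent_mul_of_isHomogeneous _ (hf₀ j) (hδN j)
      rw [h2]
      refine Submodule.sum_mem _ fun j _ => ?_
      rw [(homogeneousComponent_isHomogeneous (N - δ j) (q j)).eq_sum_monomial, Finset.sum_mul]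
      refine Submodule.sum_mem _ fun β _ => ?_
      have h4 : ∀ c : K, monomial β.1 c * f₀ j = c • map (φ f₀) (P ⟨j, β⟩) := by
        intro c
        simp only [P, map_mul, map_monomial, map_one, hφ f₀ hf₀]
        rw [← smul_mul_assoc, smul_monomial, smul_eq_mul, mul_one]
      rw [h4]
      exact Submodule.smul_mem _ _ (Submodule.subset_span ⟨⟨j, β⟩, rfl⟩))
    refine ⟨r, ⟨N, fun α hα => ?_⟩, hr⟩
    have h5 : Ideal.span (Set.range P) ≤ S := by
      rw [Ideal.span_le]
      rintro _ ⟨c, rfl⟩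
      exact Ideal.mul_mem_left _ _ (Ideal.subset_span ⟨_, rfl⟩)
    exact h5 (hr' α hα)
  have hex' : ∃ r ∈ gens, φ f₀ r ≠ 0 := by
    by_contra! hcon
    obtain ⟨r, hr, hr'⟩ := hex
    have : I ≤ RingHom.ker (φ f₀) := by
      rw [← hgens]
      exact Ideal.span_le.2 fun s hs => hcon s hs
    exact hr' (this hr)
  obtain ⟨r, hrg, hr⟩ := hex'
  have hrI : r ∈ I := by rw [← hgens]; exact Submodule.subset_span hrg
  let v : ι → J × (σ →₀ ℕ) := fun c => (c.1, c.2.1)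
  have hev : ∀ f : J → MvPolynomial σ K,
      eval (fun c => coeff c.2 (f c.1)) (rename v (map (Int.castRingHom K) r)) = φ f r := by
    intro f
    rw [eval_rename, eval_map]
    rfl
  refine ⟨rename v (map (Int.castRingHom K) r), ?_, ?_, ?_⟩
  · refine (totalDegree_rename_le _ _).trans (le_trans ?_ (Finset.le_sup (f := totalDegree) hrg))
    exact Finset.sup_mono (support_map_subset _ _)
  · rwa [hev]
  · intro f hf hne x hx
    rw [hev] at hne
    obtain ⟨N, hN⟩ := hrI
    have hker : S ≤ RingHom.ker ((eval x).comp (map (φ f))) := by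
      refine Ideal.span_le.2 ?_
      rintro _ ⟨j, rfl⟩
      simp [RingHom.mem_ker, hφ f hf, hx]
    funext i
    have h1 := hker (hN (Finsupp.single i N) (by simp))
    simp only [RingHom.mem_ker, RingHom.comp_apply, map_monomial, eval_monomial, mul_eq_zero, hne,
      false_or] at h1
    rw [Finsupp.prod_single_index (by simp)] at h1
    exact eq_zero_of_pow_eq_zero h1

/-! ### Hypersurfaces under the gradient map -/

/-- Pascal's rule, applied `e` times, with each increment bounded by the last. It bounds the
dimension of the forms of degree `k + e` modulo multiples of a form of degree `e`. -/
theorem Nat.multichoose_add_le (n e k : ℕ) :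
    (n + 2).multichoose (k + e) ≤ (n + 2).multichoose k + e * (n + 1).multichoose (k + e) := by
  induction e with
  | zero => simp
  | succ e ih =>
    have h1 : (n + 2).multichoose (k + (e + 1)) =
        (n + 1).multichoose (k + (e + 1)) + (n + 2).multichoose (k + e) :=
      Nat.multichoose_succ_succ (n + 1) (k + e)
    have h2 : (n + 1).multichoose (k + e) ≤ (n + 1).multichoose (k + (e + 1)) := by
      rw [← add_assoc, Nat.multichoose_succ_succ]; omega
    rw [h1]
    nlinarith

/-- For large `t`, the forms of degree `t` in `k + 2` variables outnumber those of degree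
`t (e - 1)` modulo a form of degree `e`. -/
theorem exists_multichoose_lt (k e : ℕ) (he : 2 ≤ e) :
    ∃ t : ℕ, e ≤ t * (e - 1) ∧ (k + 2).multichoose (t * (e - 1)) <
      (k + 2).multichoose t + (k + 2).multichoose (t * (e - 1) - e) := by
  obtain ⟨f, rfl⟩ : ∃ f, e = f + 2 := ⟨e - 2, by omega⟩
  set e := f + 2
  -- Up to the factor `(k + 1)!`, the comparison is between `(t + 1) ^ (k + 1)` and `e * (e * (t +
  -- 1)) ^ k`, which asks for `t + 1 > e ^ (k + 1) * (k + 1)!`. The summand `2` secures `e ≤ t * (e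
  -- - 1)`.
  let t := e ^ (k + 1) * (k + 1).factorial + 2
  have hsub : e - 1 = f + 1 := by omega
  have ht : e ≤ t * (e - 1) := by
    rw [hsub]
    have : 2 * (f + 1) ≤ t * (f + 1) := Nat.mul_le_mul_right _ (by omega)
    omega
  refine ⟨t, ht, ?_⟩
  set T := t * (e - 1) with hT
  have h1 := Nat.multichoose_add_le k e (T - e)
  rw [Nat.sub_add_cancel ht] at h1
  suffices h : e * (k + 1).multichoose T < (k + 2).multichoose t by omega
  have h2 : (k + 1).multichoose T ≤ (e * (t + 1)) ^ k := by
    rw [Nat.multichoose_eq, show k + 1 + T - 1 = T + k by omega,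
      Nat.choose_symm_add]
    refine (Nat.choose_add_le_add_one_pow T k).trans (Nat.pow_le_pow_left ?_ k)
    have : T ≤ t * e := Nat.mul_le_mul_left _ (by omega)
    nlinarith
  have h3 : (t + 1) ^ (k + 1) ≤ (k + 2).multichoose t * (k + 1).factorial := by
    rw [Nat.multichoose_eq, show k + 2 + t - 1 = t + (k + 1) by omega, Nat.choose_symm_add]
    have h := (t + (k + 1)).pow_sub_le_descFactorial (k + 1)
    rw [Nat.descFactorial_eq_factorial_mul_choose,
      show t + (k + 1) + 1 - (k + 1) = t + 1 by omega] at h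
    linarith
  have h4 : e ^ (k + 1) * (k + 1).factorial < t + 1 := by omega
  have h5 : e * (e * (t + 1)) ^ k * (k + 1).factorial < (t + 1) ^ (k + 1) := by
    calc e * (e * (t + 1)) ^ k * (k + 1).factorial
        = (e ^ (k + 1) * (k + 1).factorial) * (t + 1) ^ k := by rw [mul_pow]; ring
      _ < (t + 1) * (t + 1) ^ k := Nat.mul_lt_mul_of_pos_right h4 (by positivity)
      _ = _ := by ring
  have h6 : e * (k + 1).multichoose T * (k + 1).factorial <
      (k + 2).multichoose t * (k + 1).factorial :=
    lt_of_le_of_lt (Nat.mul_le_mul_right _ (Nat.mul_le_mul_left _ h2)) (h5.trans_le h3)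
  exact Nat.lt_of_mul_lt_mul_right h6

/-- The form of degree `N` with given coefficients. -/
noncomputable def formOfCoeffs (σ K : Type*) [Fintype σ] [DecidableEq σ] [Field K] (N : ℕ) :
    (exponentsOfDegree σ N → K) →ₗ[K] MvPolynomial σ K :=
  ∑ α : exponentsOfDegree σ N, (monomial α.1).comp (LinearMap.proj α)

theorem formOfCoeffs_apply {σ K : Type*} [Fintype σ] [DecidableEq σ] [Field K] {N : ℕ}
    (v : exponentsOfDegree σ N → K) :
    formOfCoeffs σ K N v = ∑ α, monomial α.1 (v α) := by
  simp [formOfCoeffs]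

theorem isHomogeneous_formOfCoeffs {σ K : Type*} [Fintype σ] [DecidableEq σ] [Field K] {N : ℕ}
    (v : exponentsOfDegree σ N → K) : (formOfCoeffs σ K N v).IsHomogeneous N := by
  rw [formOfCoeffs_apply]
  exact IsHomogeneous.sum _ _ _ fun α _ => isHomogeneous_monomial _ (mem_exponentsOfDegree.1 α.2)

theorem coeff_formOfCoeffs {σ K : Type*} [Fintype σ] [DecidableEq σ] [Field K] {N : ℕ}
    (v : exponentsOfDegree σ N → K) (α : exponentsOfDegree σ N) :
    coeff α.1 (formOfCoeffs σ K N v) = v α := by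
  rw [formOfCoeffs_apply, coeff_sum, Finset.sum_eq_single α]
  · simp
  · intro β _ hβ
    rw [coeff_monomial, if_neg fun h => hβ (Subtype.ext h)]
  · simp

theorem formOfCoeffs_eq_zero {σ K : Type*} [Fintype σ] [DecidableEq σ] [Field K] {N : ℕ}
    {v : exponentsOfDegree σ N → K} (h : formOfCoeffs σ K N v = 0) : v = 0 := by
  funext α
  rw [← coeff_formOfCoeffs v α, h]
  simp

/-- The gradient of a form maps the hypersurface it defines into another hypersurface, whose
degree depends on the degree and the number of variables only. -/
theorem exists_dvd_aeval_pderiv (k e : ℕ) (he : 2 ≤ e) :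
    ∃ t : ℕ, ∀ (K : Type) [Field K] (F : MvPolynomial (Fin (k + 2)) K), F.IsHomogeneous e →
      F ≠ 0 → ∃ Ψ : MvPolynomial (Fin (k + 2)) K, Ψ.IsHomogeneous t ∧ Ψ ≠ 0 ∧
        F ∣ aeval (fun i => pderiv i F) Ψ := by
  obtain ⟨t, ht, hlt⟩ := exists_multichoose_lt k e he
  refine ⟨t, fun K _ F hF hF0 => ?_⟩
  set T := t * (e - 1)
  let σ := Fin (k + 2)
  have hdeg : ∀ Ψ : MvPolynomial σ K, Ψ.IsHomogeneous t →
      (aeval (fun i => pderiv i F) Ψ).IsHomogeneous T := by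
    intro Ψ hΨ
    have h := hΨ.aeval (fun i => pderiv i F) (fun i => hF.pderiv (i := i))
    rwa [mul_comm] at h
  let ev : MvPolynomial σ K →ₗ[K] (exponentsOfDegree σ T → K) :=
    LinearMap.pi fun β => lcoeff K β.1
  have hev : ∀ p : MvPolynomial σ K, p.IsHomogeneous T → ev p = 0 → p = 0 := by
    intro p hp h
    ext β
    by_cases hβ : β.degree = T
    · exact congrFun h ⟨β, mem_exponentsOfDegree.2 hβ⟩
    · rw [hp.coeff_eq_zero hβ, coeff_zero]
  -- In terms of forms, this is `(Ψ, Q) ↦ Ψ(∇F) - F * Q`. Its source is larger than its target, and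
  -- a kernel element with `Ψ = 0` would have `F * Q = 0`, hence `Q = 0`.
  let L : ((exponentsOfDegree σ t → K) × (exponentsOfDegree σ (T - e) → K)) →ₗ[K]
      (exponentsOfDegree σ T → K) :=
    ev.comp (((aeval (fun i => pderiv i F)).toLinearMap.comp (formOfCoeffs σ K t)).coprod
      (-(LinearMap.mulLeft K F).comp (formOfCoeffs σ K (T - e))))
  have hker : LinearMap.ker L ≠ ⊥ := by
    apply LinearMap.ker_ne_bot_of_finrank_lt
    simp only [Module.finrank_prod, Module.finrank_fintype_fun_eq_card, Fintype.card_coe,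
      card_exponentsOfDegree, σ, Fintype.card_fin]
    exact hlt
  obtain ⟨⟨u, w⟩, huw, hne⟩ := Submodule.exists_mem_ne_zero_of_ne_bot hker
  have hL : aeval (fun i => pderiv i F) (formOfCoeffs σ K t u) -
      F * formOfCoeffs σ K (T - e) w = 0 := by
    refine hev _ ((hdeg _ (isHomogeneous_formOfCoeffs u)).sub ?_) ?_
    · have h := hF.mul (isHomogeneous_formOfCoeffs w)
      rwa [Nat.add_sub_cancel' ht] at h
    · rw [sub_eq_add_neg]
      exact huw
  refine ⟨formOfCoeffs σ K t u, isHomogeneous_formOfCoeffs u, fun h => ?_,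
    ⟨_, sub_eq_zero.1 hL⟩⟩
  rw [h, map_zero, zero_sub, neg_eq_zero] at hL
  refine hne (Prod.ext (formOfCoeffs_eq_zero h) (formOfCoeffs_eq_zero ?_))
  exact (mul_eq_zero.1 hL).resolve_left hF0

/-! ### Linear sections and the dimension of cones -/

/-- The linear form with coefficient vector `l`. -/
noncomputable def linearForm {σ K : Type*} [Fintype σ] [CommRing K] (l : σ → K) :
    MvPolynomial σ K :=
  ∑ i, C (l i) * X i

theorem isHomogeneous_linearForm {σ K : Type*} [Fintype σ] [CommRing K] (l : σ → K) :
    (linearForm l).IsHomogeneous 1 :=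
  IsHomogeneous.sum _ _ _ fun _ _ => isHomogeneous_C_mul_X _ _

theorem eval_linearForm {σ K : Type*} [Fintype σ] [CommRing K] (l x : σ → K) :
    eval x (linearForm l) = ∑ i, l i * x i := by
  simp [linearForm]

/-- Incomparability: in an integral extension, contraction of primes is strictly monotone.
Injectivity of the algebra map is not needed. -/
theorem ringKrullDim_le_of_isIntegral (R S : Type*) [CommRing R] [CommRing S] [Algebra R S]
    [Algebra.IsIntegral R S] : ringKrullDim S ≤ ringKrullDim R := by
  refine Order.krullDim_le_of_strictMono
    (fun P : PrimeSpectrum S => PrimeSpectrum.comap (algebraMap R S) P) fun P Q h => ?_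
  obtain ⟨hle, x, hxQ, hxP⟩ := SetLike.lt_iff_le_and_exists.1
    (show P.asIdeal < Q.asIdeal from h)
  exact Ideal.comap_lt_comap_of_integral_mem_sdiff hle ⟨hxQ, hxP⟩
    (Algebra.IsIntegral.isIntegral (R := R) x)

theorem RingHom.Finite.ringKrullDim_le {R S : Type*} [CommRing R] [CommRing S] {f : R →+* S}
    (hf : f.Finite) : ringKrullDim S ≤ ringKrullDim R := by
  let _ : Algebra R S := f.toAlgebra
  have : Module.Finite R S := hf
  have : Algebra.IsIntegral R S := Algebra.IsIntegral.of_finite R S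
  exact ringKrullDim_le_of_isIntegral R S

theorem eq_vanishingIdeal_zero_of_X_mem {σ K : Type*} [Finite σ] [Field K]
    {P : Ideal (MvPolynomial σ K)} (hP : P ≠ ⊤) (h : ∀ i, X i ∈ P) :
    P = vanishingIdeal K {(0 : σ → K)} := by
  have h1 : idealOfVars σ K ≤ P := by
    rw [idealOfVars, Ideal.span_le]
    rintro _ ⟨i, rfl⟩
    exact h i
  have h2 : vanishingIdeal K {(0 : σ → K)} ≤ P := by
    refine le_trans (fun p hp => ?_) h1
    rw [mem_vanishingIdeal_singleton_iff] at hp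
    rw [← pow_one (idealOfVars σ K), mem_pow_idealOfVars_iff]
    intro α hα
    by_contra hlt
    have h0 : α = 0 := by
      rw [← Finsupp.degree_eq_zero_iff]; omega
    subst h0
    rw [mem_support_iff] at hα
    apply hα
    rw [← constantCoeff_eq, ← hp]
    simp
  exact ((inferInstance : (vanishingIdeal K {(0 : σ → K)}).IsMaximal).eq_of_le hP h2).symm

/-- The linear forms in a prime ideal make up a proper subspace, unless the prime is the ideal of
the origin. Over an infinite field some `l` therefore avoids all other minimal primes of `J`, and a
chain of primes above `J` and `l` extends downwards by one of these. -/
theorem exists_linearForm_dim_le {σ K : Type*} [Fintype σ] [Field K] [Infinite K] (s : ℕ)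
    (i₀ : σ) (J : Ideal (MvPolynomial σ K))
    (hJ : ringKrullDim (MvPolynomial σ K ⧸ J) ≤ (s + 1 : ℕ)) :
    ∃ l : σ → K, l i₀ ≠ 0 ∧ ringKrullDim (MvPolynomial σ K ⧸ J ⊔ Ideal.span {linearForm l}) ≤ s := by
  classical
  let M : Ideal (MvPolynomial σ K) := vanishingIdeal K {(0 : σ → K)}
  have hM : M.IsMaximal := inferInstance
  let lin : (σ → K) →ₗ[K] MvPolynomial σ K :=
    ∑ i, (LinearMap.proj i).smulRight (X i : MvPolynomial σ K)
  have hlin : ∀ l, lin l = linearForm l := fun l => by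
    simp [lin, linearForm, smul_eq_C_mul]
  let U : Ideal (MvPolynomial σ K) → Submodule K (σ → K) := fun P =>
    (P.restrictScalars K).comap lin
  have hfin : (U '' {P | P ∈ J.minimalPrimes ∧ P ≠ M}).Finite :=
    ((Ideal.finite_minimalPrimes_of_isNoetherianRing _ J).subset fun P hP => hP.1).image U
  -- The kernel of the coordinate `i₀` joins the subspaces to be avoided, which gives `l i₀ ≠ 0`.
  have htop : (⊤ : Submodule K (σ → K)) ∉
      insert (LinearMap.ker (LinearMap.proj (R := K) (φ := fun _ : σ => K) i₀)) hfin.toFinset := by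
    rw [Finset.mem_insert, Set.Finite.mem_toFinset]
    rintro (htop | ⟨P, ⟨hP, hPM⟩, hU⟩)
    · have h : Pi.single i₀ (1 : K) ∈
          LinearMap.ker (LinearMap.proj (R := K) (φ := fun _ : σ => K) i₀) := by
        rw [← htop]; trivial
      simp at h
    refine hPM (eq_vanishingIdeal_zero_of_X_mem hP.1.1.ne_top fun i => ?_)
    have h : Pi.single i (1 : K) ∈ U P := by rw [hU]; trivial
    have h' : lin (Pi.single i (1 : K)) ∈ P := h
    rw [hlin] at h'
    simpa [linearForm, Pi.single_apply] using h'
  have hne := Subspace.biUnion_ne_univ_of_top_notMem htop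
  obtain ⟨l, hl⟩ := (Set.ne_univ_iff_exists_notMem _).1 hne
  simp only [Set.mem_iUnion, not_exists] at hl
  refine ⟨l, fun h => hl _ (Finset.mem_insert_self _ _) h, ?_⟩
  have hl' : ∀ P ∈ J.minimalPrimes, P ≠ M → linearForm l ∉ P := by
    intro P hP hPM hmem
    refine hl (U P) (Finset.mem_insert_of_mem (hfin.mem_toFinset.2 ⟨P, ⟨hP, hPM⟩, rfl⟩)) ?_
    change lin l ∈ P
    rwa [hlin]
  rw [ringKrullDim_quotient] at hJ ⊢
  refine iSup_le fun c => ?_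
  have hle : J ≤ c.head.1.asIdeal := le_sup_left.trans c.head.2
  have hmem : linearForm l ∈ c.head.1.asIdeal :=
    c.head.2 (Ideal.mem_sup_right (Ideal.subset_span rfl))
  have := c.head.1.2
  obtain ⟨P, hP, hPle⟩ := Ideal.exists_minimalPrimes_le hle
  -- A chain that starts above the ideal of the origin has length `0`, so no extension is needed
  -- there.
  by_cases hPM : P = M
  · have h0 : c.length = 0 := by
      by_contra hpos
      have h1 : c.head < c.last := c.strictMono (Fin.pos_iff_ne_zero.2 fun h => hpos (congrArg Fin.val h))
      have h2 : c.head.1.asIdeal < c.last.1.asIdeal := h1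
      have h3 : M = c.head.1.asIdeal := hM.eq_of_le this.ne_top (hPM ▸ hPle)
      exact c.last.1.2.ne_top (hM.1.2 _ (h3 ▸ h2))
    rw [h0]
    exact_mod_cast Nat.zero_le s
  · let p : PrimeSpectrum.zeroLocus (J : Set (MvPolynomial σ K)) := ⟨⟨P, hP.1.1⟩, hP.1.2⟩
    let c' : LTSeries (PrimeSpectrum.zeroLocus (J : Set (MvPolynomial σ K))) :=
      c.map (fun Q => ⟨Q.1, fun x hx => Q.2 (Ideal.mem_sup_left hx)⟩) (fun _ _ h => h)
    have hlt : p < c'.head := by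
      refine lt_of_le_of_ne hPle fun h => hl' P hP hPM ?_
      have h' : P = c.head.1.asIdeal := congrArg (fun Q => Q.1.asIdeal) h
      rwa [h']
    have h1 := (Order.LTSeries.length_le_krullDim (c'.cons p hlt)).trans hJ
    have h2 : (c'.cons p hlt).length = c.length + 1 := by
      simp [c', LTSeries.map]
    rw [h2] at h1
    have h3 : c.length + 1 ≤ s + 1 := by exact_mod_cast h1
    exact_mod_cast Nat.le_of_succ_le_succ h3

/-- A cone of dimension at most `s` meets some linear subspace of codimension at most `s` in the
origin only. -/
theorem exists_linear_section_eq_zero {σ K : Type*} [Fintype σ] [Field K] [Infinite K] (s : ℕ)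
    (i₀ : σ) (J : Ideal (MvPolynomial σ K))
    (hcone : ∀ x ∈ zeroLocus K J, ∀ c : K, c • x ∈ zeroLocus K J)
    (hJ : ringKrullDim (MvPolynomial σ K ⧸ J) ≤ s) :
    ∃ l : Fin s → σ → K, (∀ j, l j i₀ ≠ 0) ∧ ∀ x ∈ zeroLocus K J, (∀ j, ∑ i, l j i * x i = 0) → x = 0 := by
  induction s generalizing J with
  | zero =>
    refine ⟨Fin.elim0, fun j => j.elim0, fun x hx _ => ?_⟩
    by_contra hx0
    obtain ⟨i, hi⟩ := Function.ne_iff.1 hx0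
    -- Restriction to the line through the origin and `x`. Its kernel lies strictly below the ideal
    -- of `x`, and both contain `J`, which contradicts dimension `0`.
    let ψ : MvPolynomial σ K →ₐ[K] Polynomial K :=
      aeval fun i => Polynomial.C (x i) * Polynomial.X
    have hψ : ∀ (c : K) p, Polynomial.eval c (ψ p) = aeval (c • x) p := by
      intro c p
      have h : (Polynomial.aeval c).comp ψ = aeval (c • x) := by
        refine MvPolynomial.algHom_ext fun i => ?_
        rw [AlgHom.comp_apply, aeval_X, aeval_X, map_mul, Polynomial.aeval_C, Polynomial.aeval_X,
          mul_comm]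
        rfl
      rw [← h, AlgHom.comp_apply, Polynomial.coe_aeval_eq_eval]
    let P : PrimeSpectrum.zeroLocus (J : Set (MvPolynomial σ K)) :=
      ⟨⟨RingHom.ker ψ, RingHom.ker_isPrime _⟩, fun p hp => by
        refine Polynomial.funext fun c => ?_
        rw [hψ, Polynomial.eval_zero]
        exact hcone x hx c p hp⟩
    let Q : PrimeSpectrum.zeroLocus (J : Set (MvPolynomial σ K)) :=
      ⟨⟨vanishingIdeal K {x}, inferInstance⟩, fun p hp =>
        (mem_vanishingIdeal_singleton_iff x p).2 (hx p hp)⟩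
    have hPQ : P < Q := by
      refine lt_of_le_of_ne (fun p hp => ?_) fun h => ?_
      · refine (mem_vanishingIdeal_singleton_iff x p).2 ?_
        have h := hψ 1 p
        rw [show ψ p = 0 from hp, one_smul] at h
        simpa using h.symm
      · have h1 : (X i - C (x i) : MvPolynomial σ K) ∈ Q.1.asIdeal :=
          (mem_vanishingIdeal_singleton_iff x _).2 (by simp)
        rw [← h] at h1
        have h2 : ψ (X i - C (x i)) = 0 := h1
        have h3 := hψ 0 (X i - C (x i))
        rw [h2] at h3
        simp at h3
        exact hi h3
    rw [ringKrullDim_quotient] at hJ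
    exact absurd (Order.krullDim_pos_iff.2 ⟨P, Q, hPQ⟩) (not_lt.2 (by simpa using hJ))
  | succ s ih =>
    obtain ⟨l, hl₀, hl⟩ := exists_linearForm_dim_le s i₀ J hJ
    have hmem : ∀ x, x ∈ zeroLocus K (J ⊔ Ideal.span {linearForm l}) ↔
        x ∈ zeroLocus K J ∧ ∑ i, l i * x i = 0 := by
      intro x
      rw [← eval_linearForm]
      constructor
      · exact fun hx => ⟨fun p hp => hx p (Ideal.mem_sup_left hp), by
          simpa [aeval_eq_eval] using hx _ (Ideal.mem_sup_right (Ideal.subset_span rfl))⟩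
      · rintro ⟨h1, h2⟩ p hp
        obtain ⟨u, hu, w, hw, rfl⟩ := Submodule.mem_sup.1 hp
        obtain ⟨z, rfl⟩ := Ideal.mem_span_singleton'.1 hw
        simp [aeval_eq_eval, h2, show eval x u = 0 from by simpa [aeval_eq_eval] using h1 u hu]
    obtain ⟨l', hl₀', hl'⟩ := ih _ (fun x hx c => by
      rw [hmem] at hx ⊢
      refine ⟨hcone x hx.1 c, ?_⟩
      simp only [Pi.smul_apply, smul_eq_mul, mul_left_comm _ c, ← Finset.mul_sum, hx.2,
        mul_zero]) hl
    refine ⟨Fin.cons l l', fun j => Fin.cases (by simpa using hl₀) (by simpa using hl₀') j,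
      fun x hx h => hl' x ((hmem x).2 ⟨hx, by simpa using h 0⟩) fun j => ?_⟩
    simpa using h j.succ

/-- For `x ∈ V`, `p(c x)` is a polynomial in `c` whose coefficients are the values at `x` of the
components of `p`. It vanishes for all `c` in an infinite field, hence so do its coefficients. -/
theorem homogeneousComponent_mem_vanishingIdeal {σ K : Type*} [Field K] [Infinite K]
    {V : Set (σ → K)} (hcone : ∀ x ∈ V, ∀ c : K, c • x ∈ V) {p : MvPolynomial σ K}
    (hp : p ∈ vanishingIdeal K V) (n : ℕ) :
    homogeneousComponent n p ∈ vanishingIdeal K V := by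
  intro x hx
  let g : Polynomial K := ∑ i ∈ Finset.range (p.totalDegree + 1),
    Polynomial.monomial i (eval x (homogeneousComponent i p))
  have hg : g = 0 := by
    refine Polynomial.funext fun c => ?_
    have h : aeval (c • x) p = 0 := hp _ (hcone x hx c)
    rw [Polynomial.eval_zero, ← h]
    conv_rhs => rw [← sum_homogeneousComponent p]
    simp only [g, Polynomial.eval_finsetSum, Polynomial.eval_monomial, map_sum]
    refine Finset.sum_congr rfl fun i _ => ?_
    rw [aeval_eq_eval, (homogeneousComponent_isHomogeneous i p).eval_smul,
      mul_comm]
  by_cases hn : n ∈ Finset.range (p.totalDegree + 1)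
  · have h := congrArg (fun q => Polynomial.coeff q n) hg
    simp only [g, Polynomial.finsetSum_coeff, Polynomial.coeff_monomial, Polynomial.coeff_zero,
      Finset.sum_ite_eq', if_pos hn] at h
    simpa [aeval_eq_eval] using h
  · rw [homogeneousComponent_eq_zero _ _ (by simpa using hn), map_zero]

/-- A graded Nakayama lemma: a quotient of a polynomial ring by a homogeneous ideal is finite over a
subring containing linear forms that generate an irrelevant ideal modulo it. -/
theorem finite_of_idealOfVars_pow_le {σ K A B : Type*} [Fintype σ] [Field K] [CommRing A]
    [CommRing B] (ψ : B →+* A) (π : MvPolynomial σ K →+* A) (hπ : Function.Surjective π)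
    (hhom : ∀ p, π p = 0 → ∀ n, π (homogeneousComponent n p) = 0)
    (hC : ∀ c, ∃ b : B, ψ b = π (C c)) {r : ℕ} (l : Fin r → σ → K)
    (hl : ∀ j, ∃ b : B, ψ b = π (linearForm (l j))) {N : ℕ}
    (hN : idealOfVars σ K ^ N ≤
      RingHom.ker π ⊔ Ideal.span (Set.range fun j => linearForm (l j))) :
    ψ.Finite := by
  classical
  let _ : Algebra B A := ψ.toAlgebra
  have hsmul : ∀ (b : B) (a : A), b • a = ψ b * a := fun _ _ => rfl
  let S : Finset A := (Finset.range (N + 1)).biUnion fun D =>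
    (exponentsOfDegree σ D).image fun α => π (monomial α 1)
  let W : Submodule B A := Submodule.span _ (S : Set A)
  have hsmall : ∀ D ≤ N, ∀ p : MvPolynomial σ K, p.IsHomogeneous D → π p ∈ W := by
    intro D hD p hp
    rw [hp.eq_sum_monomial, map_sum]
    refine Submodule.sum_mem _ fun α _ => ?_
    obtain ⟨b, hb⟩ := hC (coeff α.1 p)
    rw [← mul_one (coeff α.1 p), ← C_mul_monomial, map_mul, ← hb, ← hsmul]
    refine Submodule.smul_mem _ _ (Submodule.subset_span ?_)
    exact Finset.mem_biUnion.2 ⟨D, Finset.mem_range.2 (by omega),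
      Finset.mem_image.2 ⟨α.1, α.2, rfl⟩⟩
  have hall : ∀ D, ∀ p : MvPolynomial σ K, p.IsHomogeneous D → π p ∈ W := by
    intro D
    induction D with
    | zero => exact hsmall 0 (Nat.zero_le _)
    | succ D ih =>
      intro p hp
      by_cases hD : D + 1 ≤ N
      · exact hsmall _ hD p hp
      -- Beyond degree `N`, a form is a combination of the linear forms modulo the kernel; comparing
      -- components of degree `D + 1` leaves coefficients of degree `D`, to which induction applies.
      have h1 : p ∈ idealOfVars σ K ^ N := by
        rw [mem_pow_idealOfVars_iff]
        intro α hα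
        by_contra hlt
        exact (mem_support_iff.1 hα) (hp.coeff_eq_zero (by omega))
      obtain ⟨u, hu, w, hw, huw⟩ := Submodule.mem_sup.1 (hN h1)
      obtain ⟨q, rfl⟩ := Ideal.mem_span_range_iff_exists_fun.1 hw
      have h2 : p = homogeneousComponent (D + 1) u +
          ∑ j, homogeneousComponent D (q j) * linearForm (l j) := by
        have h3 := congrArg (homogeneousComponent (D + 1)) huw
        rw [map_add, map_sum, homogeneousComponent_eq_self hp] at h3
        rw [← h3]
        congr 1
        refine Finset.sum_congr rfl fun j _ => ?_
        have h4 := homogeneousComponent_mul_of_isHomogeneous (N := D + 1) (q j)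
          (isHomogeneous_linearForm (l j)) (by omega)
        rwa [Nat.add_sub_cancel] at h4
      rw [h2, map_add, hhom u hu, zero_add, map_sum]
      refine Submodule.sum_mem _ fun j _ => ?_
      obtain ⟨b, hb⟩ := hl j
      rw [map_mul, ← hb, mul_comm, ← hsmul]
      exact Submodule.smul_mem _ _ (ih _ (homogeneousComponent_isHomogeneous _ _))
  change Module.Finite B A
  refine ⟨⟨S, eq_top_iff.2 ?_⟩⟩
  rintro a -
  obtain ⟨p, rfl⟩ := hπ a
  change π p ∈ W
  rw [← sum_homogeneousComponent p, map_sum]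
  exact Submodule.sum_mem _ fun D _ => hall D _ (homogeneousComponent_isHomogeneous D p)

/-- A closed cone meeting a linear subspace of codimension at most `r` in the origin only has
dimension at most `r`. -/
theorem affineDim_le_of_linear_section {σ K : Type*} [Fintype σ] [Field K] [IsAlgClosed K]
    {V : Set (σ → K)} (hclosed : zeroLocus K (vanishingIdeal K V) ⊆ V)
    (hcone : ∀ x ∈ V, ∀ c : K, c • x ∈ V) {r : ℕ} (l : Fin r → σ → K)
    (hl : ∀ x ∈ V, (∀ j, ∑ i, l j i * x i = 0) → x = 0) : affineDim V ≤ r := by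
  classical
  have : Infinite K := IsAlgClosed.instInfinite
  let I := vanishingIdeal K V
  let A := MvPolynomial σ K ⧸ I
  let π : MvPolynomial σ K →+* A := Ideal.Quotient.mk I
  obtain ⟨N, hN⟩ := exists_pow_idealOfVars_le
    (I ⊔ Ideal.span (Set.range fun j => linearForm (l j))) (by
      intro x hx
      refine hl x (hclosed fun p hp => hx p (Ideal.mem_sup_left hp)) fun j => ?_
      rw [← eval_linearForm]
      simpa [aeval_eq_eval] using hx _ (Ideal.mem_sup_right (Ideal.subset_span ⟨j, rfl⟩)))
  -- As in Noether normalization, the `r` linear forms present the coordinate ring as finite over a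
  -- polynomial ring in `r` variables.
  let ψ : MvPolynomial (Fin r) K →+* A :=
    eval₂Hom (π.comp C) fun j => π (linearForm (l j))
  have hker : RingHom.ker π = I := Ideal.mk_ker
  have hfin : ψ.Finite := by
    refine finite_of_idealOfVars_pow_le ψ π Ideal.Quotient.mk_surjective (fun p hp n => ?_)
      (fun c => ⟨C c, by simp [ψ]⟩) l (fun j => ⟨X j, by simp [ψ]⟩) (by rwa [hker])
    rw [← RingHom.mem_ker, hker] at hp ⊢
    exact homogeneousComponent_mem_vanishingIdeal hcone hp n
  refine hfin.ringKrullDim_le.trans ?_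
  simp

/-! ### Restriction to a hyperplane -/

/-- The restriction of a polynomial to the affine hyperplane on which the last coordinate is
`c - ∑ aᵢ xᵢ`. -/
noncomputable def restrictHyperplane {R : Type*} [CommRing R] {m : ℕ} (a : Fin m → R) (c : R) :
    MvPolynomial (Fin (m + 1)) R →ₐ[R] MvPolynomial (Fin m) R :=
  aeval (Fin.snoc (α := fun _ => MvPolynomial (Fin m) R) X (C c - linearForm a))

/-- The point of the hyperplane with given first coordinates. -/
def hyperplanePoint {R : Type*} [CommRing R] {m : ℕ} (a : Fin m → R) (c : R) (y : Fin m → R) :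
    Fin (m + 1) → R :=
  Fin.snoc (α := fun _ => R) y (c - ∑ i, a i * y i)

theorem eval_restrictHyperplane {R : Type*} [CommRing R] {m : ℕ} (a : Fin m → R) (c : R)
    (y : Fin m → R) (f : MvPolynomial (Fin (m + 1)) R) :
    eval y (restrictHyperplane a c f) = eval (hyperplanePoint a c y) f := by
  have h : (aeval y).comp (restrictHyperplane a c) = aeval (R := R) (hyperplanePoint a c y) := by
    refine MvPolynomial.algHom_ext fun i => ?_
    refine Fin.lastCases ?_ (fun i => ?_) i
    · simp [restrictHyperplane, hyperplanePoint, aeval_eq_eval, eval_linearForm]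
    · simp [restrictHyperplane, hyperplanePoint]
  have h' := congrArg (fun φ => φ f) h
  simpa [aeval_eq_eval] using h'

theorem isHomogeneous_restrictHyperplane {R : Type*} [CommRing R] {m e : ℕ} (a : Fin m → R)
    {f : MvPolynomial (Fin (m + 1)) R} (hf : f.IsHomogeneous e) :
    (restrictHyperplane a 0 f).IsHomogeneous e := by
  have h := hf.aeval (n := 1)
    (Fin.snoc (α := fun _ => MvPolynomial (Fin m) R) X (C 0 - linearForm a)) (fun i => by
      refine Fin.lastCases ?_ (fun i => ?_) i
      · simpa using (isHomogeneous_linearForm a).neg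
      · simpa using isHomogeneous_X R i)
  rwa [one_mul] at h

/-- The chain rule. At a singular point of the restriction it forces the gradient to be parallel to
the normal `(a, 1)`. -/
theorem pderiv_restrictHyperplane {R : Type*} [CommRing R] {m : ℕ} (a : Fin m → R) (c : R)
    (i : Fin m) (f : MvPolynomial (Fin (m + 1)) R) :
    pderiv i (restrictHyperplane a c f) = restrictHyperplane a c (pderiv i.castSucc f) -
      C (a i) * restrictHyperplane a c (pderiv (Fin.last m) f) := by
  classical
  induction f using MvPolynomial.induction_on with
  | C r =>
    simp [restrictHyperplane]
  | add p q hp hq => simp only [map_add, hp, hq]; ring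
  | mul_X p j hp =>
    have hX : pderiv i (restrictHyperplane a c (X j)) =
        restrictHyperplane a c (pderiv i.castSucc (X j)) -
          C (a i) * restrictHyperplane a c (pderiv (Fin.last m) (X j)) := by
      refine Fin.lastCases ?_ (fun j => ?_) j
      · have h2 : (Fin.last m) ≠ i.castSucc := (Fin.castSucc_lt_last i).ne'
        simp [restrictHyperplane, linearForm, pderiv_X, Pi.single_apply, h2]
      · simp [restrictHyperplane, pderiv_X, Pi.single_apply, Fin.ext_iff, (Fin.is_lt j).ne]
    simp only [map_mul, Derivation.leibniz, hp, hX, smul_eq_mul, map_add]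
    ring

theorem totalDegree_aeval_le_of_forall_le_one {σ τ R : Type*} [CommRing R]
    {w : σ → MvPolynomial τ R} (hw : ∀ i, (w i).totalDegree ≤ 1) (p : MvPolynomial σ R) :
    (aeval w p).totalDegree ≤ p.totalDegree := by
  rw [aeval_def, eval₂_eq]
  refine (totalDegree_finsetSum_le fun α hα => ?_)
  refine (totalDegree_mul _ _).trans ?_
  rw [algebraMap_eq, totalDegree_C, zero_add]
  refine (totalDegree_finsetProd _ _).trans (le_trans ?_ (le_totalDegree hα))
  rw [Finsupp.sum]
  refine Finset.sum_le_sum fun i _ => (totalDegree_pow _ _).trans ?_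
  exact (Nat.mul_le_mul_left _ (hw i)).trans (by rw [mul_one])

/-! ### A uniform Bertini theorem -/

/-- The singular locus of the hypersurface `F = 0` in affine space. -/
def singularPoints {σ K : Type*} [CommRing K] (F : MvPolynomial σ K) : Set (σ → K) :=
  {x | eval x F = 0 ∧ ∀ i, eval x (pderiv i F) = 0}

/-- A nonzero form does not vanish identically on the affine chart where the last coordinate is
one. -/
theorem aeval_snoc_one_ne_zero {K : Type*} [Field K] [Infinite K] {m t : ℕ}
    {Ψ : MvPolynomial (Fin (m + 1)) K} (hΨ : Ψ.IsHomogeneous t) (h0 : Ψ ≠ 0) :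
    aeval (Fin.snoc (α := fun _ => MvPolynomial (Fin m) K) X 1) Ψ ≠ 0 := by
  -- The extra factor yields a point off `Ψ = 0` with nonzero last coordinate, which can be scaled
  -- into the chart.
  have h1 : Ψ * X (Fin.last m) ≠ 0 := mul_ne_zero h0 (X_ne_zero _)
  obtain ⟨b, hb⟩ : ∃ b, eval b (Ψ * X (Fin.last m)) ≠ 0 := by
    by_contra! h
    exact h1 (MvPolynomial.funext fun x => by rw [h x, map_zero])
  rw [map_mul, eval_X] at hb
  have hbl := right_ne_zero_of_mul hb
  set c := b (Fin.last m)
  intro h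
  have h2 : eval (fun i : Fin m => c⁻¹ * b i.castSucc)
      (aeval (Fin.snoc (α := fun _ => MvPolynomial (Fin m) K) X 1) Ψ) = eval (c⁻¹ • b) Ψ := by
    have h3 : (aeval fun i : Fin m => c⁻¹ * b i.castSucc).comp
        (aeval (Fin.snoc (α := fun _ => MvPolynomial (Fin m) K) X 1)) =
        aeval (R := K) (c⁻¹ • b) := by
      refine MvPolynomial.algHom_ext fun i => ?_
      refine Fin.lastCases ?_ (fun i => ?_) i
      · simp [c, inv_mul_cancel₀ hbl]
      · simp
    have h' := congrArg (fun φ => φ Ψ) h3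
    simpa [aeval_eq_eval] using h'
  rw [h, map_zero, hΨ.eval_smul] at h2
  exact mul_ne_zero (pow_ne_zero t (inv_ne_zero hbl)) (left_ne_zero_of_mul hb) h2.symm

theorem exists_ne_zero_forall_sum_eq_zero {K : Type*} [Field K] {m r : ℕ} (h : r < m)
    (l : Fin r → Fin m → K) : ∃ y : Fin m → K, y ≠ 0 ∧ ∀ j, ∑ i, l j i * y i = 0 := by
  have hker : LinearMap.ker (Matrix.mulVecLin (Matrix.of l)) ≠ ⊥ :=
    LinearMap.ker_ne_bot_of_finrank_lt (by simpa using h)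
  obtain ⟨y, hy, hy0⟩ := Submodule.exists_mem_ne_zero_of_ne_bot hker
  exact ⟨y, hy0, fun j => congrFun hy j⟩

/-- A Bertini theorem: if the singular locus of a form meets a linear subspace of codimension `r + 1`
in the origin only, then the singular locus of its restriction to a hyperplane `x_m = - ∑ aᵢ xᵢ`
meets a linear subspace of codimension `r` in the origin only, unless `a` lies on a hypersurface whose
degree is bounded independently of the form and the field. -/
theorem exists_bertini_bound (m e r : ℕ) (he : 2 ≤ e) (hr : r < m) :
    ∃ D : ℕ, ∀ (K : Type) [Field K] [IsAlgClosed K] (F : MvPolynomial (Fin (m + 1)) K),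
      F.IsHomogeneous e → F ≠ 0 → ∀ l : Fin (r + 1) → Fin (m + 1) → K, l 0 (Fin.last m) ≠ 0 →
      (∀ x ∈ singularPoints F, (∀ j, ∑ i, l j i * x i = 0) → x = 0) →
      ∃ Φ : MvPolynomial (Fin m) K, Φ ≠ 0 ∧ Φ.totalDegree ≤ D ∧ ∀ a : Fin m → K, eval a Φ ≠ 0 →
        restrictHyperplane a 0 F ≠ 0 ∧ ∃ l' : Fin r → Fin m → K,
          ∀ y ∈ singularPoints (restrictHyperplane a 0 F),
            (∀ j, ∑ i, l' j i * y i = 0) → y = 0 := by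
  obtain ⟨k, rfl⟩ : ∃ k, m = k + 1 := ⟨m - 1, by omega⟩
  let δ : Option (Fin (k + 2)) ⊕ Fin (r + 1) → ℕ :=
    Sum.elim (fun o => o.elim e fun _ => e - 1) fun _ => 1
  obtain ⟨D, hD⟩ := exists_elimination_bound (σ := Fin (k + 2)) δ
  obtain ⟨t, ht⟩ := exists_dvd_aeval_pderiv k e he
  refine ⟨D + t, fun K _ _ F hF hF0 l hl0 hl => ?_⟩
  have hinf : Infinite K := IsAlgClosed.instInfinite
  -- `F`, its partial derivatives and the linear forms, with `l 0` replaced by the normal `(a, 1)`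
  -- of the hyperplane.
  let fam : (Fin (k + 1) → K) → Option (Fin (k + 2)) ⊕ Fin (r + 1) → MvPolynomial (Fin (k + 2)) K :=
    fun a => Sum.elim (fun o => o.elim F fun i => pderiv i F)
      (Fin.cons (linearForm (Fin.snoc (α := fun _ => K) a 1)) fun j => linearForm (l j.succ))
  have hfam : ∀ a j, (fam a j).IsHomogeneous (δ j) := by
    rintro a ((_ | i) | j)
    · exact hF
    · exact hF.pderiv
    · refine Fin.cases ?_ (fun j => ?_) j
      · exact isHomogeneous_linearForm _
      · exact isHomogeneous_linearForm _
  have hzero : ∀ a x, (∀ j, eval x (fam a j) = 0) ↔ x ∈ singularPoints F ∧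
      (∑ i, a i * x i.castSucc + x (Fin.last _) = 0) ∧
      ∀ j : Fin r, ∑ i, l j.succ i * x i = 0 := by
    intro a x
    simp only [Sum.forall, Option.forall, Fin.forall_fin_succ (n := r), fam, Sum.elim_inl,
      Sum.elim_inr, Option.elim, Fin.cons_zero, Fin.cons_succ, eval_linearForm, singularPoints,
      Set.mem_ofPred_eq]
    rw [Fin.sum_univ_castSucc]
    simp
  -- Scaling `l 0` to last coefficient `1` gives one parameter at which the family has only the
  -- trivial zero, so the elimination condition is not vacuous.
  let a₀ : Fin (k + 1) → K := fun i => (l 0 (Fin.last _))⁻¹ * l 0 i.castSucc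
  obtain ⟨Θ, hΘD, hΘ0, hΘ⟩ := hD K (fam a₀) (hfam a₀) (by
    intro x hx
    obtain ⟨h1, h2, h3⟩ := (hzero a₀ x).1 hx
    refine hl x h1 fun j => Fin.cases ?_ h3 j
    rw [Fin.sum_univ_castSucc]
    have h4 := congrArg (fun z => l 0 (Fin.last _) * z) h2
    simp only [mul_add, mul_zero, Finset.mul_sum, a₀, mul_assoc] at h4
    simpa only [mul_inv_cancel_left₀ hl0] using h4)
  obtain ⟨Ψ, hΨ, hΨ0, hdvd⟩ := ht K F hF hF0
  -- The same family with `a` generic. Its coefficients have degree at most `1` in `a`, so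
  -- substituting them into `Θ` does not raise the degree.
  let gfam : Option (Fin (k + 2)) ⊕ Fin (r + 1) →
      MvPolynomial (Fin (k + 2)) (MvPolynomial (Fin (k + 1)) K) :=
    Sum.elim (fun o => map C (o.elim F fun i => pderiv i F))
      (Fin.cons (linearForm (Fin.snoc (α := fun _ => MvPolynomial (Fin (k + 1)) K) X 1))
        fun j => map C (linearForm (l j.succ)))
  have hgfam : ∀ a j, map (eval a) (gfam j) = fam a j := by
    have hC : ∀ a : Fin (k + 1) → K, (eval a).comp C = RingHom.id K := fun a => by ext; simp
    rintro a (o | j)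
    · simp [gfam, fam, map_map, hC, MvPolynomial.map_id]
    · refine Fin.cases ?_ (fun j => ?_) j
      · simp [gfam, fam, linearForm, Fin.sum_univ_castSucc]
      · simp [gfam, fam, map_map, hC, MvPolynomial.map_id]
  have hdeg : ∀ j α, (coeff α (gfam j)).totalDegree ≤ 1 := by
    rintro (o | j) α
    · simp [gfam, coeff_map]
    · refine Fin.cases ?_ (fun j => ?_) j
      · simp only [gfam, Sum.elim_inr, Fin.cons_zero, linearForm, coeff_sum, coeff_C_mul]
        refine totalDegree_finsetSum_le fun i _ => ?_
        refine (totalDegree_mul _ _).trans ?_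
        have h1 : (coeff α (X i : MvPolynomial (Fin (k + 2))
            (MvPolynomial (Fin (k + 1)) K))).totalDegree = 0 := by
          rw [coeff_X]
          split_ifs <;> simp
        rw [h1, add_zero]
        refine Fin.lastCases ?_ (fun i => ?_) i
        · simp
        · simp
      · simp [gfam, coeff_map]
  let w : (Option (Fin (k + 2)) ⊕ Fin (r + 1)) × (Fin (k + 2) →₀ ℕ) → MvPolynomial (Fin (k + 1)) K :=
    fun c => coeff c.2 (gfam c.1)
  have hw1 : ∀ c, (w c).totalDegree ≤ 1 := fun c => hdeg c.1 c.2
  have hw : ∀ a, eval a (aeval w Θ) = eval (fun c => coeff c.2 (fam a c.1)) Θ := by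
    intro a
    have h3 : (aeval a).comp (aeval w) =
        aeval (R := K) fun c : (Option (Fin (k + 2)) ⊕ Fin (r + 1)) × (Fin (k + 2) →₀ ℕ) =>
          coeff c.2 (fam a c.1) := by
      refine MvPolynomial.algHom_ext fun c => ?_
      simp only [AlgHom.comp_apply, aeval_X, w, ← hgfam, coeff_map, aeval_eq_eval]
    have h' := congrArg (fun φ => φ Θ) h3
    simpa [aeval_eq_eval] using h'
  let v : Fin (k + 2) → MvPolynomial (Fin (k + 1)) K :=
    Fin.snoc (α := fun _ => MvPolynomial (Fin (k + 1)) K) X 1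
  have hv : ∀ a, eval a (aeval v Ψ) = eval (Fin.snoc (α := fun _ => K) a 1) Ψ := by
    intro a
    have h3 : (aeval a).comp (aeval v) =
        aeval (R := K) (Fin.snoc (α := fun _ => K) a 1 : Fin (k + 2) → K) := by
      refine MvPolynomial.algHom_ext fun i => ?_
      refine Fin.lastCases ?_ (fun i => ?_) i
      · simp [v]
      · simp [v]
    have h' := congrArg (fun φ => φ Ψ) h3
    simpa [aeval_eq_eval] using h'
  have hv1 : ∀ i, (v i).totalDegree ≤ 1 := by
    intro i
    refine Fin.lastCases ?_ (fun i => ?_) i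
    · simp [v]
    · simp [v]
  have hv0 : aeval v Ψ ≠ 0 := aeval_snoc_one_ne_zero hΨ hΨ0
  clear_value w v
  refine ⟨aeval w Θ * aeval v Ψ, mul_ne_zero (fun h => ?_) hv0, ?_,
    fun a ha => ?_⟩
  · apply hΘ0
    rw [← hw, h, map_zero]
  · refine (totalDegree_mul _ _).trans (add_le_add ?_ ?_)
    · exact (totalDegree_aeval_le_of_forall_le_one hw1 Θ).trans hΘD
    · exact (totalDegree_aeval_le_of_forall_le_one hv1 Ψ).trans hΨ.totalDegree_le
  · rw [map_mul, hw, hv] at ha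
    have hΘa := hΘ (fam a) (hfam a) (left_ne_zero_of_mul ha)
    have hΨa := right_ne_zero_of_mul ha
    -- The remaining forms `l j.succ`, written in the coordinates of the hyperplane.
    let l' : Fin r → Fin (k + 1) → K := fun j i => l j.succ i.castSucc - l j.succ (Fin.last _) * a i
    have hmain : ∀ y ∈ singularPoints (restrictHyperplane a 0 F),
        (∀ j, ∑ i, l' j i * y i = 0) → y = 0 := by
      rintro y ⟨hy, hy'⟩ hly
      set x := hyperplanePoint a 0 y with hx
      have hxc : ∀ i : Fin (k + 1), x i.castSucc = y i := fun i => by simp [hx, hyperplanePoint]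
      have hxl : x (Fin.last _) = - ∑ i, a i * y i := by simp [hx, hyperplanePoint]
      rw [eval_restrictHyperplane] at hy
      set μ := eval x (pderiv (Fin.last _) F)
      have hgrad : (fun i => eval x (pderiv i F)) = μ • Fin.snoc (α := fun _ => K) a 1 := by
        funext i
        refine Fin.lastCases ?_ (fun i => ?_) i
        · simp [μ]
        · have h := hy' i
          rw [pderiv_restrictHyperplane, map_sub, map_mul, eval_C, eval_restrictHyperplane,
            eval_restrictHyperplane, sub_eq_zero] at h
          simp only [Pi.smul_apply, Fin.snoc_castSucc, smul_eq_mul]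
          rw [h, mul_comm]
      -- `F ∣ Ψ(∇F)` and `F(x) = 0` give `0 = Ψ(μ • (a, 1)) = μ ^ t * Ψ(a, 1)`.
      have hμ : μ = 0 := by
        obtain ⟨Q, hQ⟩ := hdvd
        have h1 : eval x (aeval (fun i => pderiv i F) Ψ) =
            eval (fun i => eval x (pderiv i F)) Ψ := by
          have h3 : (aeval x).comp (aeval fun i => pderiv i F) =
              aeval (R := K) (fun i => eval x (pderiv i F)) := by
            refine MvPolynomial.algHom_ext fun i => ?_
            simp [aeval_eq_eval]
          have h' := congrArg (fun φ => φ Ψ) h3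
          simpa [aeval_eq_eval] using h'
        rw [hQ, map_mul, hy, zero_mul, hgrad, hΨ.eval_smul] at h1
        exact eq_zero_of_pow_eq_zero ((mul_eq_zero.1 h1.symm).resolve_right hΨa)
      have hx0 : x = 0 := by
        refine hΘa x ((hzero a x).2 ⟨⟨hy, fun i => ?_⟩, ?_, fun j => ?_⟩)
        · have h := congrFun hgrad i
          rwa [hμ, zero_smul] at h
        · simp only [hxc, hxl, add_neg_cancel]
        · rw [Fin.sum_univ_castSucc]
          simp only [hxc, hxl]
          rw [← hly j]
          simp only [l', sub_mul, Finset.sum_sub_distrib, mul_assoc, ← Finset.mul_sum]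
          ring
      funext i
      rw [← hxc, hx0]
      rfl
    refine ⟨fun h => ?_, l', hmain⟩
    -- If the restriction were zero, every point would be singular, but `r < m` linear forms have a
    -- nontrivial common zero.
    obtain ⟨y, hy0, hy⟩ := exists_ne_zero_forall_sum_eq_zero hr l'
    refine hy0 (hmain y ?_ hy)
    rw [h]
    simp [singularPoints]

/-! ### A common nonvanishing point over several fields -/

/-- Finitely many nonzero polynomials of bounded degree over various fields have a common
nonvanishing point with natural coordinates in a box that embeds into each of the fields. -/
theorem exists_common_nonvanishing {ι : Type*} [Fintype ι] (k : ι → Type*) [∀ i, Field (k i)]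
    {m D N : ℕ} (Φ : ∀ i, MvPolynomial (Fin m) (k i)) (hΦ : ∀ i, Φ i ≠ 0)
    (hD : ∀ i, (Φ i).totalDegree ≤ D) (hN : Fintype.card ι * D < N)
    (hinj : ∀ i, Set.InjOn (Nat.cast : ℕ → k i) (Finset.range N)) :
    ∃ a : Fin m → ℕ, (∀ j, a j < N) ∧ ∀ i, eval (fun j => (a j : k i)) (Φ i) ≠ 0 := by
  classical
  let box : Finset (Fin m → ℕ) := Fintype.piFinset fun _ => Finset.range N
  let bad : ι → Finset (Fin m → ℕ) := fun i =>
    box.filter fun a => eval (fun j => (a j : k i)) (Φ i) = 0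
  have hNpos : 0 < N := by omega
  have hbad : ∀ i, (bad i).card * N ≤ D * N ^ m := by
    intro i
    let S : Finset (k i) := (Finset.range N).image Nat.cast
    have hS : S.card = N := by
      rw [Finset.card_image_of_injOn (hinj i), Finset.card_range]
    have h1 := schwartz_zippel_totalDegree (hΦ i) S
    rw [hS, div_le_div_iff₀ (by positivity) (by positivity)] at h1
    have h2 : (bad i).card ≤
        ((Fintype.piFinset fun _ : Fin m => S).filter fun f => eval f (Φ i) = 0).card := by
      refine Finset.card_le_card_of_injOn (fun a j => (a j : k i)) (fun a ha => ?_)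
        (fun a ha b hb hab => ?_)
      · obtain ⟨h3, h4⟩ := Finset.mem_filter.1 ha
        refine Finset.mem_coe.2 (Finset.mem_filter.2 ⟨Fintype.mem_piFinset.2 fun j => ?_, h4⟩)
        exact Finset.mem_image_of_mem _ (Fintype.mem_piFinset.1 h3 j)
      · funext j
        exact hinj i (Fintype.mem_piFinset.1 (Finset.mem_filter.1 ha).1 j)
          (Fintype.mem_piFinset.1 (Finset.mem_filter.1 hb).1 j) (congrFun hab j)
    have h3 : ((Fintype.piFinset fun _ : Fin m => S).filter fun f => eval f (Φ i) = 0).card * N ≤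
        (Φ i).totalDegree * N ^ m := by exact_mod_cast h1
    exact (Nat.mul_le_mul_right _ h2).trans (h3.trans (Nat.mul_le_mul_right _ (hD i)))
  -- Union bound: each bad set fills at most the fraction `D / N` of the box.
  have hlt : (Finset.univ.biUnion bad).card < box.card := by
    have h1 : (Finset.univ.biUnion bad).card * N ≤ Fintype.card ι * D * N ^ m := by
      refine (Nat.mul_le_mul_right _ Finset.card_biUnion_le).trans ?_
      rw [Finset.sum_mul]
      refine (Finset.sum_le_sum fun i _ => hbad i).trans ?_
      simp [mul_assoc]
    have h2 : box.card = N ^ m := by simp [box]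
    rw [h2]
    refine Nat.lt_of_mul_lt_mul_right (a := N) (lt_of_le_of_lt h1 ?_)
    rw [mul_comm (N ^ m)]
    exact Nat.mul_lt_mul_of_pos_right hN (by positivity)
  obtain ⟨a, ha, ha'⟩ := Finset.exists_mem_notMem_of_card_lt_card hlt
  refine ⟨a, fun j => Finset.mem_range.1 (Fintype.mem_piFinset.1 ha j), fun i h => ha' ?_⟩
  exact Finset.mem_biUnion.2 ⟨i, Finset.mem_univ i, Finset.mem_filter.2 ⟨ha, h⟩⟩

/-! ### Leading forms of hyperplane sections -/

theorem MvPolynomial.homogeneousComponent_add_mul {σ R : Type*} [CommRing R] {a b : ℕ}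
    {u v : MvPolynomial σ R} (hu : u.totalDegree ≤ a) (hv : v.totalDegree ≤ b) :
    homogeneousComponent (a + b) (u * v) =
      homogeneousComponent a u * homogeneousComponent b v := by
  classical
  have key : ∀ (f : MvPolynomial σ R) (n : ℕ), f.totalDegree ≤ n → ∀ α : σ →₀ ℕ,
      n < α.degree → coeff α f = 0 := fun f n hf α hα =>
    coeff_eq_zero_of_totalDegree_lt (lt_of_le_of_lt hf hα)
  ext α
  rw [coeff_homogeneousComponent, coeff_mul, coeff_mul]
  split_ifs with h
  · refine Finset.sum_congr rfl fun x hx => ?_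
    have hx' := Finset.HasAntidiagonal.mem_antidiagonal.1 hx
    have hdeg : x.1.degree + x.2.degree = a + b := by rw [← h, ← hx', map_add]
    rw [coeff_homogeneousComponent, coeff_homogeneousComponent]
    rcases lt_trichotomy x.1.degree a with h1 | h1 | h1
    · rw [if_neg h1.ne, key v b hv _ (by omega), mul_zero, zero_mul]
    · rw [if_pos h1, if_pos (by omega)]
    · rw [if_neg h1.ne', key u a hu _ h1, zero_mul, zero_mul]
  · refine (Finset.sum_eq_zero fun x hx => ?_).symm
    have hx' := Finset.HasAntidiagonal.mem_antidiagonal.1 hx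
    rw [coeff_homogeneousComponent, coeff_homogeneousComponent]
    split_ifs with h1 h2
    · exact absurd (by rw [← hx', map_add, h1, h2]) h
    · rw [mul_zero]
    · rw [zero_mul]
    · rw [zero_mul]

theorem MvPolynomial.homogeneousComponent_map {σ R S : Type*} [CommRing R] [CommRing S]
    (φ : R →+* S) (n : ℕ) (f : MvPolynomial σ R) :
    homogeneousComponent n (map φ f) = map φ (homogeneousComponent n f) := by
  classical
  ext α
  rw [coeff_homogeneousComponent, coeff_map, coeff_map, coeff_homogeneousComponent]
  split_ifs <;> simp

theorem MvPolynomial.totalDegree_lt_of_homogeneousComponent_eq_zero {σ R : Type*} [CommRing R]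
    {n : ℕ} (hn : 0 < n) {f : MvPolynomial σ R} (hf : f.totalDegree ≤ n)
    (h : homogeneousComponent n f = 0) : f.totalDegree < n := by
  classical
  rw [totalDegree, Finset.sup_lt_iff hn]
  intro α hα
  have h1 : α.degree ≤ n := (le_totalDegree hα).trans hf
  refine lt_of_le_of_ne h1 fun h2 => (mem_support_iff.1 hα) ?_
  rw [← coeff_zero (R := R) α, ← h, coeff_homogeneousComponent,
    if_pos (show α.degree = n from h2)]

theorem MvPolynomial.totalDegree_eq_of_homogeneousComponent_ne_zero {σ R : Type*} [CommRing R]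
    {n : ℕ} {f : MvPolynomial σ R} (hf : f.totalDegree ≤ n)
    (h : homogeneousComponent n f ≠ 0) : f.totalDegree = n :=
  le_antisymm hf (not_lt.1 fun hlt => h (homogeneousComponent_eq_zero _ _ hlt))

theorem totalDegree_linearForm_le {σ R : Type*} [Fintype σ] [CommRing R] (l : σ → R) :
    (linearForm l).totalDegree ≤ 1 :=
  (isHomogeneous_linearForm l).totalDegree_le

theorem totalDegree_restrictHyperplane_le {R : Type*} [CommRing R] {m : ℕ} (a : Fin m → R) (c : R)
    (f : MvPolynomial (Fin (m + 1)) R) :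
    (restrictHyperplane a c f).totalDegree ≤ f.totalDegree := by
  refine totalDegree_aeval_le_of_forall_le_one (fun i => ?_) f
  refine Fin.lastCases ?_ (fun i => ?_) i
  · rw [Fin.snoc_last]
    refine (totalDegree_sub _ _).trans (max_le (by simp) (totalDegree_linearForm_le a))
  · rw [Fin.snoc_castSucc]
    exact (isHomogeneous_X R i).totalDegree_le

/-- Both sides are multiplicative in the monomial, so it suffices to treat the variables, where `c`
is only a constant term. -/
theorem homogeneousComponent_restrictHyperplane_monomial {R : Type*} [CommRing R] {m : ℕ}
    (a : Fin m → R) (c : R) (α : Fin (m + 1) →₀ ℕ) :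
    homogeneousComponent α.degree (restrictHyperplane a c (monomial α 1)) =
      restrictHyperplane a 0 (monomial α 1) := by
  have hdeg : ∀ α : Fin (m + 1) →₀ ℕ,
      (restrictHyperplane a c (monomial α 1)).totalDegree ≤ α.degree := fun α =>
    (totalDegree_restrictHyperplane_le a c _).trans
      (isHomogeneous_monomial (1 : R) rfl).totalDegree_le
  have hadd : ∀ α β : Fin (m + 1) →₀ ℕ,
      homogeneousComponent α.degree (restrictHyperplane a c (monomial α 1)) =
        restrictHyperplane a 0 (monomial α 1) →
      homogeneousComponent β.degree (restrictHyperplane a c (monomial β 1)) =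
        restrictHyperplane a 0 (monomial β 1) →
      homogeneousComponent (α + β).degree (restrictHyperplane a c (monomial (α + β) 1)) =
        restrictHyperplane a 0 (monomial (α + β) 1) := by
    intro α β hα hβ
    have h : (monomial (α + β) 1 : MvPolynomial (Fin (m + 1)) R) =
        monomial α 1 * monomial β 1 := by rw [monomial_mul, one_mul]
    rw [h, map_mul (restrictHyperplane a c), map_mul (restrictHyperplane a 0), map_add,
      homogeneousComponent_add_mul (hdeg α) (hdeg β), hα, hβ]
  have hzero : homogeneousComponent (0 : Fin (m + 1) →₀ ℕ).degree
      (restrictHyperplane a c (monomial 0 1)) = restrictHyperplane a 0 (monomial 0 1) := by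
    have h : (monomial 0 1 : MvPolynomial (Fin (m + 1)) R) = 1 := rfl
    rw [h, map_one (restrictHyperplane a c), map_one (restrictHyperplane a 0), map_zero]
    exact homogeneousComponent_eq_self (isHomogeneous_one _ _)
  induction α using Finsupp.induction_linear with
  | zero => exact hzero
  | add α β hα hβ => exact hadd α β hα hβ
  | single i n =>
    induction n with
    | zero => rw [Finsupp.single_zero]; exact hzero
    | succ n ih =>
      rw [Finsupp.single_add]
      refine hadd _ _ ih ?_
      have h : (monomial (Finsupp.single i 1) 1 : MvPolynomial (Fin (m + 1)) R) = X i := rfl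
      rw [h, Finsupp.degree_single]
      refine Fin.lastCases ?_ (fun i => ?_) i
      · simp only [restrictHyperplane, aeval_X, Fin.snoc_last, map_sub, map_zero, zero_sub]
        rw [homogeneousComponent_eq_self (isHomogeneous_linearForm a),
          homogeneousComponent_of_mem (isHomogeneous_C (Fin m) c)]
        simp
      · simp only [restrictHyperplane, aeval_X, Fin.snoc_castSucc]
        exact homogeneousComponent_eq_self (isHomogeneous_X R i)

/-- The right side is free of `c`: this is why one `a` serves all parallel sections at once. -/
theorem homogeneousComponent_restrictHyperplane {R : Type*} [CommRing R] {m e : ℕ}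
    (a : Fin m → R) (c : R) {f : MvPolynomial (Fin (m + 1)) R} (hf : f.totalDegree ≤ e) :
    homogeneousComponent e (restrictHyperplane a c f) =
      restrictHyperplane a 0 (homogeneousComponent e f) := by
  conv_lhs => rw [f.as_sum]
  conv_rhs => rw [f.as_sum]
  simp only [map_sum]
  refine Finset.sum_congr rfl fun α hα => ?_
  have hle : α.degree ≤ e := (le_totalDegree hα).trans hf
  have hC : monomial α (coeff α f) = C (coeff α f) * monomial α 1 := by rw [C_mul_monomial, mul_one]
  rcases hle.lt_or_eq with h | h
  · rw [homogeneousComponent_of_mem (isHomogeneous_monomial (coeff α f) rfl), if_neg h.ne',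
      map_zero]
    refine homogeneousComponent_eq_zero _ _ (lt_of_le_of_lt ?_ h)
    exact (totalDegree_restrictHyperplane_le a c _).trans
      (isHomogeneous_monomial (coeff α f) rfl).totalDegree_le
  · rw [homogeneousComponent_eq_self (isHomogeneous_monomial (coeff α f) h), hC,
      map_mul (restrictHyperplane a c), map_mul (restrictHyperplane a 0), ← h]
    simp only [restrictHyperplane, algHom_C, algebraMap_eq]
    rw [homogeneousComponent_C_mul]
    congr 1
    exact homogeneousComponent_restrictHyperplane_monomial a c α

theorem leadingForm_restrictHyperplane {R : Type*} [CommRing R] {m e : ℕ} (a : Fin m → R) (c : R)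
    {f : MvPolynomial (Fin (m + 1)) R} (hf : f.totalDegree ≤ e)
    (h : restrictHyperplane a 0 (homogeneousComponent e f) ≠ 0) :
    (restrictHyperplane a c f).totalDegree = e ∧
      leadingForm (restrictHyperplane a c f) =
        restrictHyperplane a 0 (homogeneousComponent e f) := by
  rw [← homogeneousComponent_restrictHyperplane a c hf] at h ⊢
  have h1 := totalDegree_eq_of_homogeneousComponent_ne_zero
    ((totalDegree_restrictHyperplane_le a c f).trans hf) h
  exact ⟨h1, by rw [leadingForm, h1]⟩

theorem map_restrictHyperplane {R S : Type*} [CommRing R] [CommRing S] (φ : R →+* S) {m : ℕ}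
    (a : Fin m → R) (c : R) (f : MvPolynomial (Fin (m + 1)) R) :
    map φ (restrictHyperplane a c f) = restrictHyperplane (fun i => φ (a i)) (φ c) (map φ f) := by
  induction f using MvPolynomial.induction_on with
  | C r => simp [restrictHyperplane]
  | add p q hp hq => simp only [map_add, hp, hq]
  | mul_X p j hp =>
    rw [map_mul, map_mul, map_mul, map_mul, hp]
    congr 1
    refine Fin.lastCases ?_ (fun i => ?_) j
    · simp [restrictHyperplane, linearForm]
    · simp [restrictHyperplane]

/-! ### Shear matrices -/

/-- The unipotent matrix whose hyperplane sections are the hyperplanes `x_m + ∑ aᵢ xᵢ = c`. -/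
def shearMatrix {m : ℕ} (a : Fin m → ℤ) : Matrix.SpecialLinearGroup (Fin (m + 1)) ℤ :=
  ⟨Matrix.updateRow 1 (Fin.last m) (Fin.snoc (α := fun _ => ℤ) (fun i => - a i) 1), by
    rw [← Matrix.cramer_transpose_apply, Matrix.transpose_one, Matrix.cramer_one]
    simp⟩

theorem hyperplaneSection_shearMatrix {m : ℕ} (a : Fin m → ℤ) (c : ℤ)
    (f : MvPolynomial (Fin (m + 1)) ℤ) :
    hyperplaneSection (shearMatrix a) c f = restrictHyperplane a c f := by
  have h : (bind₁ (Fin.snoc (α := fun _ => MvPolynomial (Fin m) ℤ) X (C c))).comp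
      (bind₁ (fun i => ∑ j, C ((shearMatrix a).1 i j) * X j)) = restrictHyperplane a c := by
    refine MvPolynomial.algHom_ext fun i => ?_
    rw [AlgHom.comp_apply, bind₁_X_right, map_sum, Fin.sum_univ_castSucc]
    refine Fin.lastCases ?_ (fun i => ?_) i
    · simp [shearMatrix, restrictHyperplane, linearForm]
      ring
    · simp [shearMatrix, restrictHyperplane, Matrix.updateRow_apply, Matrix.one_apply,
        (Fin.castSucc_lt_last i).ne, apply_ite, Finset.sum_ite_eq]
  exact congrArg (fun φ => φ f) h

theorem abs_shearMatrix_le {m : ℕ} (a : Fin m → ℤ) {K : ℤ} (hK : 1 ≤ K) (ha : ∀ i, |a i| ≤ K)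
    (i j : Fin (m + 1)) : |(shearMatrix a).1 i j| ≤ K := by
  simp only [shearMatrix, Matrix.updateRow_apply, Matrix.one_apply]
  split_ifs
  · refine Fin.lastCases ?_ (fun j => ?_) j
    · simpa using hK
    · simpa using ha j
  · simpa using hK
  · simp; omega

/-! ### Singular loci and reduction modulo `p` -/

theorem singularLocus_eq_singularPoints {σ : Type*} (p : ℕ) [Fact p.Prime]
    (F : MvPolynomial σ (ZMod p)) :
    singularLocus p F =
      singularPoints (map (algebraMap (ZMod p) (AlgebraicClosure (ZMod p))) F) := by
  ext x
  simp only [singularLocus, singularPoints, Set.mem_ofPred_eq, aeval_def, eval₂_eq_eval_map,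
    pderiv_map]

theorem smul_mem_singularPoints {σ K : Type*} [CommRing K] {F : MvPolynomial σ K} {e : ℕ}
    (hF : F.IsHomogeneous e) {x : σ → K} (hx : x ∈ singularPoints F) (c : K) :
    c • x ∈ singularPoints F :=
  ⟨by rw [hF.eval_smul, hx.1, mul_zero], fun i => by
    rw [(hF.pderiv (i := i)).eval_smul, hx.2 i, mul_zero]⟩

theorem zeroLocus_vanishingIdeal_singularPoints {σ K : Type*} [Field K] (F : MvPolynomial σ K) :
    zeroLocus K (vanishingIdeal K (singularPoints F)) ⊆ singularPoints F := fun x hx =>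
  ⟨by simpa [aeval_eq_eval] using hx F fun y hy => by simpa [aeval_eq_eval] using hy.1,
    fun i => by
      simpa [aeval_eq_eval] using hx (pderiv i F) fun y hy => by
        simpa [aeval_eq_eval] using hy.2 i⟩

theorem zero_mem_singularPoints {σ K : Type*} [CommRing K] {F : MvPolynomial σ K} {e : ℕ}
    (he : 2 ≤ e) (hF : F.IsHomogeneous e) : (0 : σ → K) ∈ singularPoints F := by
  have key : ∀ {f : MvPolynomial σ K} {n : ℕ}, 0 < n → f.IsHomogeneous n → eval 0 f = 0 := by
    intro f n hn hf
    have h := hf.eval_smul 0 0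
    rwa [zero_smul, zero_pow hn.ne', zero_mul] at h
  exact ⟨key (by omega) hF, fun i => key (by omega) hF.pderiv⟩

/-- The origin is singular since `2 ≤ e`, which excludes `⊥`; lying in the hypersurface `F = 0`
costs one dimension. The bound `s ≤ m` later provides the `r < m` of the Bertini theorem. -/
theorem exists_affineDim_singularPoints_eq {K : Type*} [Field K] {m e : ℕ} (he : 2 ≤ e)
    {F : MvPolynomial (Fin (m + 1)) K} (hF : F.IsHomogeneous e) (hF0 : F ≠ 0) :
    ∃ s ≤ m, affineDim (singularPoints F) = s := by
  have hne : vanishingIdeal K (singularPoints F) ≠ ⊤ := by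
    rw [Ne, Ideal.eq_top_iff_one]
    intro h
    simpa using h 0 (zero_mem_singularPoints he hF)
  have hnon : Nontrivial (MvPolynomial (Fin (m + 1)) K ⧸ vanishingIdeal K (singularPoints F)) :=
    Ideal.Quotient.nontrivial_iff.2 hne
  have h0 : 0 ≤ affineDim (singularPoints F) := ringKrullDim_nonneg_of_nontrivial
  have h1 : affineDim (singularPoints F) + 1 ≤ ((m + 1 : ℕ) : WithBot ℕ∞) := by
    have h := ringKrullDim_succ_le_of_surjective
      (Ideal.Quotient.mk (vanishingIdeal K (singularPoints F))) Ideal.Quotient.mk_surjective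
      (mem_nonZeroDivisors_of_ne_zero hF0) (Ideal.Quotient.eq_zero_iff_mem.2 fun x hx => by
        simpa [aeval_eq_eval] using hx.1)
    simpa [affineDim] using h
  generalize affineDim (singularPoints F) = D at h0 h1
  induction D with
  | bot => simp at h0
  | coe D =>
    induction D with
    | top =>
      have h2 : (⊤ : ℕ∞) + 1 ≤ ((m + 1 : ℕ) : ℕ∞) := by exact_mod_cast h1
      rw [top_add, top_le_iff] at h2
      exact absurd h2 (ENat.natCast_ne_top _)
    | coe s =>
      refine ⟨s, ?_, rfl⟩
      have h2 : s + 1 ≤ m + 1 := by exact_mod_cast h1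
      omega

theorem leadingForm_isHomogeneous {σ R : Type*} [CommRing R] (f : MvPolynomial σ R) :
    (leadingForm f).IsHomogeneous f.totalDegree :=
  homogeneousComponent_isHomogeneous _ _

theorem modP_restrictHyperplane {m : ℕ} (p : ℕ) (a : Fin m → ℤ) (c : ℤ)
    (f : MvPolynomial (Fin (m + 1)) ℤ) :
    modP p (restrictHyperplane a c f) =
      restrictHyperplane (fun i => (a i : ZMod p)) (c : ZMod p) (modP p f) :=
  map_restrictHyperplane (Int.castRingHom (ZMod p)) a c f

theorem pencil_restrictHyperplane {m : ℕ} (p : ℕ) (a : Fin m → ℤ) (c : ℤ)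
    (h g : MvPolynomial (Fin (m + 1)) ℤ) (γ : ZMod p) :
    pencil p (restrictHyperplane a c h) (restrictHyperplane a c g) γ =
      restrictHyperplane (fun i => (a i : ZMod p)) (c : ZMod p) (pencil p h g γ) := by
  rw [pencil, pencil, modP_restrictHyperplane, modP_restrictHyperplane, map_sub, map_mul]
  congr 2
  simp [restrictHyperplane]

theorem totalDegree_modP_le {σ : Type*} (p : ℕ) (f : MvPolynomial σ ℤ) :
    (modP p f).totalDegree ≤ f.totalDegree :=
  Finset.sup_mono (support_map_subset _ _)

theorem IsNonsingularForm.ne_zero {m p : ℕ} [Fact p.Prime] {F : MvPolynomial (Fin (m + 1)) (ZMod p)}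
    (hF : IsNonsingularForm p F) : F ≠ 0 := by
  rintro rfl
  have h := hF (fun _ => 1) (by simp [singularLocus])
  exact one_ne_zero (congrFun h 0)

/-! ### The pencil `h - γ g` modulo `p` -/

/-- Modulo `p`, the degree `d` part of `h` is a multiple of the leading form of `g`. -/
theorem IsAdmissible.exists_homogeneousComponent_eq {m d q : ℕ}
    {h g : MvPolynomial (Fin (m + 1)) ℤ} (H : IsAdmissible d q h g) (p : ℕ) [Fact p.Prime]
    (hG : modP p (leadingForm g) ≠ 0) :
    ∃ κ : ZMod p, modP p (homogeneousComponent d h) = C κ * modP p (leadingForm g) := by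
  rcases H.degree_h.lt_or_eq with hlt | heq
  · exact ⟨0, by simp [homogeneousComponent_eq_zero _ _ hlt, modP]⟩
  rcases H.leading_h with hlt | ⟨κ, hκ⟩
  · omega
  have hlead : homogeneousComponent d h = leadingForm h := by rw [leadingForm, heq]
  rw [hlead]
  have hint : C (κ.den : ℤ) * leadingForm h = C κ.num * leadingForm g := by
    refine map_injective (Int.castRingHom ℚ) Int.cast_injective ?_
    rw [map_mul, map_mul, hκ, map_C, map_C, ← mul_assoc, ← C_mul]
    congr 2
    simp only [eq_intCast, Int.cast_natCast]
    rw [mul_comm, Rat.mul_den_eq_num]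
  have hmod : C ((κ.den : ℤ) : ZMod p) * modP p (leadingForm h) =
      C ((κ.num : ℤ) : ZMod p) * modP p (leadingForm g) := by
    have h1 := congrArg (modP p) hint
    rwa [modP, modP, map_mul, map_mul, map_C, map_C] at h1
  -- If `p` divided the denominator, `G ≠ 0` modulo `p` would make it divide the numerator too,
  -- against lowest terms.
  have hden : ((κ.den : ℤ) : ZMod p) ≠ 0 := by
    intro h0
    rw [h0, C_0, zero_mul] at hmod
    have hnum : ((κ.num : ℤ) : ZMod p) = 0 := by
      have h2 := (mul_eq_zero.1 hmod.symm).resolve_right hG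
      rwa [← C_0, C_inj] at h2
    rw [ZMod.intCast_zmod_eq_zero_iff_dvd] at h0 hnum
    have h3 : p ∣ κ.den := by exact_mod_cast h0
    have h4 : p ∣ κ.num.natAbs := Int.natCast_dvd.1 hnum
    have h5 := Nat.dvd_gcd h4 h3
    rw [κ.reduced] at h5
    exact (Fact.out : p.Prime).one_lt.ne' (Nat.dvd_one.1 h5)
  refine ⟨((κ.den : ℤ) : ZMod p)⁻¹ * ((κ.num : ℤ) : ZMod p), ?_⟩
  rw [C_mul, mul_assoc, ← hmod, ← mul_assoc, ← C_mul, inv_mul_cancel₀ hden, C_1, one_mul]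

/-- There is exactly one `γ` for which `h - γ g` has degree less than `d` modulo `p`. -/
theorem IsAdmissible.exists_pencil_degree_lt_iff {m d q : ℕ}
    {h g : MvPolynomial (Fin (m + 1)) ℤ} (H : IsAdmissible d q h g) (p : ℕ) [Fact p.Prime]
    (hG : modP p (leadingForm g) ≠ 0) :
    ∃ γ : ZMod p, ∀ γ' : ZMod p, (pencil p h g γ').totalDegree < d ↔ γ' = γ := by
  obtain ⟨κ, hκ⟩ := H.exists_homogeneousComponent_eq p hG
  refine ⟨κ, fun γ' => ?_⟩
  have hle : (pencil p h g γ').totalDegree ≤ d := by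
    refine (totalDegree_sub _ _).trans (max_le ?_ ?_)
    · exact (totalDegree_modP_le p h).trans H.degree_h
    · refine (totalDegree_mul _ _).trans ?_
      rw [totalDegree_C, zero_add]
      exact (totalDegree_modP_le p g).trans H.degree_g.le
  have hcomp : homogeneousComponent d (pencil p h g γ') =
      C (κ - γ') * modP p (leadingForm g) := by
    rw [pencil, map_sub, homogeneousComponent_C_mul, modP, modP, homogeneousComponent_map,
      homogeneousComponent_map, C_sub, sub_mul, ← hκ, leadingForm, H.degree_g]
    rfl
  have hd : 0 < d := by have := H.three_le; omega
  constructor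
  · intro hlt
    rw [homogeneousComponent_eq_zero _ _ hlt] at hcomp
    have h1 := (mul_eq_zero.1 hcomp.symm).resolve_right hG
    rw [← C_0, C_inj, sub_eq_zero] at h1
    exact h1.symm
  · rintro rfl
    refine totalDegree_lt_of_homogeneousComponent_eq_zero hd hle ?_
    rw [hcomp, sub_self, C_0, zero_mul]

/-! ### Good hyperplanes at each prime, and the choice of `M` -/

theorem affineDim_le_of_singularPoints_section {K : Type*} [Field K] [IsAlgClosed K] {m e r : ℕ}
    {F : MvPolynomial (Fin m) K} (hF : F.IsHomogeneous e) (l : Fin r → Fin m → K)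
    (hl : ∀ y ∈ singularPoints F, (∀ j, ∑ i, l j i * y i = 0) → y = 0) :
    affineDim (singularPoints F) ≤ r :=
  affineDim_le_of_linear_section (zeroLocus_vanishingIdeal_singularPoints F)
    (fun _ hx c => smul_mem_singularPoints hF hx c) l hl

/-- Restriction to a hyperplane through the origin commutes with the passage to the algebraic
closure. -/
theorem restrictHyperplane_map_algebraMap {p m : ℕ} [Fact p.Prime] (a : Fin m → ℤ)
    (F : MvPolynomial (Fin (m + 1)) (ZMod p)) :
    map (algebraMap (ZMod p) (AlgebraicClosure (ZMod p)))
        (restrictHyperplane (fun i => (a i : ZMod p)) 0 F) =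
      restrictHyperplane (fun i => (a i : AlgebraicClosure (ZMod p))) 0
        (map (algebraMap (ZMod p) (AlgebraicClosure (ZMod p))) F) := by
  rw [map_restrictHyperplane]
  simp

/-- For each prime factor of the modulus, the vectors `a` for which the hyperplane sections along
`x_m = c - ∑ aᵢ xᵢ` may fail to have the required properties lie on a hypersurface of bounded
degree. -/
theorem exists_local_bound (m d : ℕ) (hm : 1 ≤ m) :
    ∃ B : ℕ, ∀ (q : ℕ) (h g : MvPolynomial (Fin (m + 1)) ℤ), IsAdmissible d q h g →
      ∀ (p : ℕ) [Fact p.Prime], p ∣ q →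
      ∃ Φ : MvPolynomial (Fin m) (AlgebraicClosure (ZMod p)), Φ ≠ 0 ∧ Φ.totalDegree ≤ B ∧
        ∀ a : Fin m → ℤ, eval (fun i => (a i : AlgebraicClosure (ZMod p))) Φ ≠ 0 →
          (∀ c : ℤ, (modP p (restrictHyperplane a c g)).totalDegree = d ∧
            IsNonsingularForm p (modP p (leadingForm (restrictHyperplane a c g)))) ∧
          ∃ (γ : ZMod p) (s : ℕ),
            (∀ γ' : ZMod p, (pencil p h g γ').totalDegree < d ↔ γ' = γ) ∧
            affineDim (singularLocus p (leadingForm (pencil p h g γ))) = s ∧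
            ∀ c : ℤ,
              2 ≤ (pencil p (restrictHyperplane a c h) (restrictHyperplane a c g) γ).totalDegree ∧
              affineDim (singularLocus p (leadingForm
                (pencil p (restrictHyperplane a c h) (restrictHyperplane a c g) γ)))
                ≤ ((max (s - 1) 0 : ℕ) : WithBot ℕ∞) := by
  have hbound := fun e r (h : 2 ≤ e ∧ r < m) => exists_bertini_bound m e r h.1 h.2
  -- The default `0` outside the range of the Bertini theorem makes `D` total, so that it can be
  -- summed over all possible `e` and `r`.
  have hbound' : ∀ e r, ∃ D : ℕ, ∀ h : 2 ≤ e ∧ r < m, (hbound e r h).choose ≤ D := fun e r => by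
    by_cases h : 2 ≤ e ∧ r < m
    · exact ⟨(hbound e r h).choose, fun _ => le_rfl⟩
    · exact ⟨0, fun h' => absurd h' h⟩
  choose D hD using hbound'
  refine ⟨D d 0 + ∑ e ∈ Finset.range d, ∑ r ∈ Finset.range m, D e r,
    fun q h g H p _ hpq => ?_⟩
  have h3 := H.three_le
  let k := AlgebraicClosure (ZMod p)
  let ι : ZMod p →+* k := algebraMap (ZMod p) k
  have hι : Function.Injective ι := ι.injective
  have hinf : Infinite k := IsAlgClosed.instInfinite
  set G := modP p (leadingForm g) with hGdef
  have hGns : IsNonsingularForm p G := H.nonsingular p hpq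
  have hG0 : G ≠ 0 := hGns.ne_zero
  have hGhom : G.IsHomogeneous d := by
    have h1 := (leadingForm_isHomogeneous g).map (Int.castRingHom (ZMod p))
    rwa [H.degree_g] at h1
  have hGcomp : G = homogeneousComponent d (modP p g) := by
    rw [hGdef, modP, modP, homogeneousComponent_map, leadingForm, H.degree_g]
  obtain ⟨γ, hγ⟩ := H.exists_pencil_degree_lt_iff p hG0
  set u := pencil p h g γ with hu
  set e := u.totalDegree with he
  have hed : e < d := (hγ γ).2 rfl
  have he2 : 2 ≤ e := H.two_le_degree p hpq γ hed
  set F := leadingForm u with hF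
  have hFhom : F.IsHomogeneous e := leadingForm_isHomogeneous u
  have hF0 : F ≠ 0 := fun h0 =>
    (totalDegree_lt_of_homogeneousComponent_eq_zero (by omega) he.ge h0).ne he
  have hFk0 : map ι F ≠ 0 := fun h0 => hF0 (map_injective ι hι (by rw [h0, map_zero]))
  have hGk0 : map ι G ≠ 0 := fun h0 => hG0 (map_injective ι hι (by rw [h0, map_zero]))
  obtain ⟨s, hsm, hs⟩ := exists_affineDim_singularPoints_eq he2 (hFhom.map ι) hFk0
  -- Natural subtraction: `s = 0` and `s = 1` both give `r = 0`, and `s ≤ r + 1` always holds. One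
  -- of the `r + 1` linear forms is given up to the hyperplane.
  set r := max (s - 1) 0 with hr
  have hrm : r < m := by omega
  obtain ⟨l, hl0, hl⟩ := exists_linear_section_eq_zero (r + 1) (Fin.last m)
    (vanishingIdeal k (singularPoints (map ι F))) (fun x hx c p hp =>
      hp _ (smul_mem_singularPoints (hFhom.map ι)
        (zeroLocus_vanishingIdeal_singularPoints _ hx) c)) (by
      change affineDim (singularPoints (map ι F)) ≤ _
      rw [hs]
      exact_mod_cast (by omega : s ≤ r + 1))
  obtain ⟨ΦF, hΦF0, hΦFD, hΦF⟩ := (hbound e r ⟨he2, hrm⟩).choose_spec k (map ι F) (hFhom.map ι)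
    hFk0 l (hl0 0) (fun x hx => hl x (zeroLocus_vanishingIdeal_le _ hx))
  -- The singular locus of `G` is already trivial, so any linear form involving the last variable
  -- will do.
  obtain ⟨ΦG, hΦG0, hΦGD, hΦG⟩ := (hbound d 0 ⟨by omega, by omega⟩).choose_spec k (map ι G)
    (hGhom.map ι) hGk0 (fun _ => Pi.single (Fin.last m) 1) (by simp) (fun x hx _ => by
      rw [← singularLocus_eq_singularPoints] at hx
      exact hGns x hx)
  refine ⟨ΦG * ΦF, mul_ne_zero hΦG0 hΦF0, ?_, fun a ha => ?_⟩
  · refine (totalDegree_mul _ _).trans (add_le_add (hΦGD.trans (hD d 0 ⟨by omega, by omega⟩)) ?_)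
    refine (hΦFD.trans (hD e r ⟨he2, hrm⟩)).trans ?_
    refine le_trans ?_ (Finset.single_le_sum
      (f := fun e => ∑ r ∈ Finset.range m, D e r) (fun _ _ => Nat.zero_le _)
      (Finset.mem_range.2 hed))
    exact Finset.single_le_sum (f := fun r => D e r) (fun _ _ => Nat.zero_le _)
      (Finset.mem_range.2 hrm)
  rw [map_mul] at ha
  obtain ⟨hGa, lG, hlG⟩ := hΦG _ (left_ne_zero_of_mul ha)
  obtain ⟨hFa, lF, hlF⟩ := hΦF _ (right_ne_zero_of_mul ha)
  rw [← restrictHyperplane_map_algebraMap] at hGa hlG hFa hlF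
  have hGa0 : restrictHyperplane (fun i => (a i : ZMod p)) 0 G ≠ 0 := fun h0 =>
    hGa (by rw [h0, map_zero])
  have hFa0 : restrictHyperplane (fun i => (a i : ZMod p)) 0 F ≠ 0 := fun h0 =>
    hFa (by rw [h0, map_zero])
  refine ⟨fun c => ?_, γ, s, hγ, by rw [singularLocus_eq_singularPoints]; exact hs, fun c => ?_⟩
  · have hgle : (modP p g).totalDegree ≤ d := (totalDegree_modP_le p g).trans H.degree_g.le
    rw [hGcomp] at hGa0
    obtain ⟨h1, h2⟩ := leadingForm_restrictHyperplane (fun i => (a i : ZMod p)) (c : ZMod p)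
      hgle hGa0
    -- The leading form is taken over `ℤ` before reduction; as the degree does not drop modulo `p`,
    -- the two operations commute.
    have h4 : (restrictHyperplane a c g).totalDegree = d := by
      refine le_antisymm ((totalDegree_restrictHyperplane_le a c g).trans H.degree_g.le) ?_
      rw [← h1, ← modP_restrictHyperplane]
      exact totalDegree_modP_le _ _
    refine ⟨by rw [modP_restrictHyperplane, h1], ?_⟩
    have h5 : modP p (leadingForm (restrictHyperplane a c g)) =
        restrictHyperplane (fun i => (a i : ZMod p)) 0 G := by
      rw [hGcomp, ← h2, leadingForm, leadingForm, h1, h4, ← modP_restrictHyperplane, modP, modP,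
        homogeneousComponent_map]
    rw [h5]
    intro y hy
    rw [singularLocus_eq_singularPoints] at hy
    exact hlG y hy fun j => j.elim0
  · rw [pencil_restrictHyperplane]
    obtain ⟨h1, h2⟩ := leadingForm_restrictHyperplane (fun i => (a i : ZMod p)) (c : ZMod p)
      he.ge hFa0
    rw [h1, h2, singularLocus_eq_singularPoints]
    exact ⟨he2, affineDim_le_of_singularPoints_section
      ((isHomogeneous_restrictHyperplane _ hFhom).map ι) lF hlF⟩

theorem IsSieveModulus.card_primeFactors_le {q : ℕ} (hq : IsSieveModulus q) :
    q.primeFactors.card ≤ 2 := by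
  rcases hq with hq | ⟨p₁, p₂, h₁, h₂, -, -, rfl⟩
  · rw [hq.primeFactors]; simp
  · rw [Nat.primeFactors_mul h₁.ne_zero h₂.ne_zero, h₁.primeFactors, h₂.primeFactors]
    exact (Finset.card_union_le _ _).trans (by simp)

theorem IsSieveModulus.ne_zero {q : ℕ} (hq : IsSieveModulus q) : q ≠ 0 := by
  rcases hq with hq | ⟨p₁, p₂, h₁, h₂, -, -, rfl⟩
  · exact hq.ne_zero
  · exact mul_ne_zero h₁.ne_zero h₂.ne_zero

theorem lemma4p2 (m d : ℕ) (hm : 1 ≤ m) :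
    ∃ K P : ℕ, ∀ (q : ℕ) (h g : MvPolynomial (Fin (m + 1)) ℤ),
      IsAdmissible d q h g → (∀ p : ℕ, p.Prime → p ∣ q → P ≤ p) →
      ∃ M : Matrix.SpecialLinearGroup (Fin (m + 1)) ℤ,
        (∀ i j, |M.1 i j| ≤ (K : ℤ)) ∧
        ∀ (p : ℕ) [Fact p.Prime], p ∣ q →
          -- the leading form of `g_{M,c}` is nonsingular modulo `p`, of degree `d`
          (∀ c : ℤ, (modP p (hyperplaneSection M c g)).totalDegree = d ∧
            IsNonsingularForm p (modP p (leadingForm (hyperplaneSection M c g)))) ∧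
          -- `γ` is the unique residue with `deg (h - γ g) < d`, and `s = s(h, g; p)`
          ∃ (γ : ZMod p) (s : ℕ),
            (∀ γ' : ZMod p, (pencil p h g γ').totalDegree < d ↔ γ' = γ) ∧
            affineDim (singularLocus p (leadingForm (pencil p h g γ))) = s ∧
            ∀ c : ℤ,
              2 ≤ (pencil p (hyperplaneSection M c h) (hyperplaneSection M c g) γ).totalDegree ∧
              affineDim (singularLocus p (leadingForm
                (pencil p (hyperplaneSection M c h) (hyperplaneSection M c g) γ)))
                ≤ ((max (s - 1) 0 : ℕ) : WithBot ℕ∞) := by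
  obtain ⟨B, hB⟩ := exists_local_bound m d hm
  -- At most two primes, each with an exceptional hypersurface of degree at most `B`, call for a box
  -- of side `N > 2 * B`. Primes `p ≥ N` keep `0, …, N - 1` distinct modulo `p`, and `N` also bounds
  -- the matrix entries.
  refine ⟨2 * B + 1, 2 * B + 1, fun q h g H hP => ?_⟩
  have hprime : ∀ i : q.primeFactors, Fact i.1.Prime := fun i =>
    ⟨Nat.prime_of_mem_primeFactors i.2⟩
  choose Φ hΦ0 hΦB hΦ using fun i : q.primeFactors =>
    hB q h g H i.1 (Nat.dvd_of_mem_primeFactors i.2)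
  obtain ⟨a, haN, ha⟩ := exists_common_nonvanishing
    (fun i : q.primeFactors => AlgebraicClosure (ZMod i.1)) (N := 2 * B + 1) Φ hΦ0 hΦB (by
      have h1 := H.modulus.card_primeFactors_le
      rw [Fintype.card_coe]
      have h2 := Nat.mul_le_mul_right B h1
      omega) (fun i => by
      intro x hx y hy hxy
      have hp : 2 * B + 1 ≤ i.1 :=
        hP i.1 (Nat.prime_of_mem_primeFactors i.2) (Nat.dvd_of_mem_primeFactors i.2)
      have h1 : ((x : ZMod i.1)) = (y : ZMod i.1) := by
        apply (algebraMap (ZMod i.1) (AlgebraicClosure (ZMod i.1))).injective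
        simpa using hxy
      rw [ZMod.natCast_eq_natCast_iff] at h1
      have hx' := Finset.mem_range.1 hx
      have hy' := Finset.mem_range.1 hy
      exact Nat.ModEq.eq_of_lt_of_lt h1 (by omega) (by omega))
  let b : Fin m → ℤ := fun j => (a j : ℤ)
  refine ⟨shearMatrix b, abs_shearMatrix_le b (by push_cast; omega) (fun i => ?_),
    fun p _ hpq => ?_⟩
  · have h1 := haN i
    simp only [b, Nat.abs_cast]
    exact_mod_cast h1.le
  · simp only [hyperplaneSection_shearMatrix]
    have hmem : p ∈ q.primeFactors :=
      Nat.mem_primeFactors.2 ⟨Fact.out, hpq, H.modulus.ne_zero⟩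
    refine hΦ ⟨p, hmem⟩ b ?_
    simpa [b] using ha ⟨p, hmem⟩
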